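/- **Setting.** Let $\mathcal K$ be a tensor triangulated category: a triangulated category with suspension $T$ and a symmetric monoidal structure $\otimes$ with unit $1$, such that all functors $a\otimes-$ and $-\otimes b$ are exact and the two resulting isomorphisms $T(a)\otimes T(b)\cong T^2(a\otimes b)$ differ by the sign $-1$. Assume that $\mathcal K$ is idempotent complete and strongly closed, i.e. there is a bi-exact internal hom functor $\underline{\hom}:\mathcal K^{\mathrm{op}}\times\mathcal K\to\mathcal K$ with natural isomorphisms $\operatorname{Hom}(a\otimes b,c)\cong\operatorname{Hom}(a,\underline{\hom}(b,c))$ such that the natural morphism $\underline{\hom}(a,1)\otimes b\to\underline{\hom}(a,b)$ is an isomorphism for all $a,b$. Let $\operatorname{Spc}(\mathcal K)$ be the set of prime ideals of $\mathcal K$ (proper full triangulated subcategories $\mathcal P$ that are thick, i.e. $a\oplus b\in\mathcal P$ implies $a,b\in\mathcal P$; that are $\otimes$-ideals; and such that $a\otimes b\in\mathcal P$ implies $a\in\mathcal P$ or $b\in\mathcal P$). Put $\operatorname{supp}(a)=\{\mathcal P\mid a\notin\mathcal P\}$ and give $\operatorname{Spc}(\mathcal K)$ the topology with basis the complements of the sets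 $\operatorname{supp}(a)$, $a\in\mathcal K$. For a quasi-compact open $U\subset\operatorname{Spc}(\mathcal K)$ with complement $Z$, let $\mathcal K_Z=\{a\in\mathcal K\mid \operatorname{supp}(a)\subset Z\}$ and let $\mathcal K(U)$ be the idempotent completion of the Verdier quotient $\mathcal K/\mathcal K_Z$. There are canonical restriction functors $\mathcal K\to\mathcal K(U)$ and $\mathcal K(U)\to\mathcal K(V)$ for $V\subset U$; "on $V$" means after restriction to $\mathcal K(V)$. **Corollary (Gluing three objects).** Let $\operatorname{Spc}(\mathcal K)=U_1\cup U_2\cup U_3$ be a covering by quasi-compact open subsets. Let $a_i\in\mathcal K(U_i)$ for $i=1,2,3$ be objects and let $\sigma_{ij}:a_j\xrightarrow{\ \sim\ }a_i$ be isomorphisms in $\mathcal K(U_i\cap U_j)$ for $1\le i<j\le 3$, satisfying the cocycle relation $\sigma_{12}\circ\sigma_{23}=\sigma_{13}$ in $\mathcal K(U_1\cap U_2\cap U_3)$. Then there exists a gluing: an object $a\in\mathcal K$ and isomorphisms $f_i:a\xrightarrow{\ \sim\ }a_i$ in $\mathcal K(U_i)$ for $i=1,2,3$ such that $\sigma_{ij}\circ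 f_j=f_i$ in $\mathcal K(U_i\cap U_j)$ for $1\le i<j\le 3$. -/

import Mathlib

open CategoryTheory CategoryTheory.Limits CategoryTheory.MonoidalCategory TopologicalSpace

universe v u

namespace TTGeometry

/-! ### Tensor triangulated categories -/

section Exact

open CategoryTheory.Pretriangulated

variable {C D : Type*} [Category* C] [Category* D]
  [Preadditive C] [HasZeroObject C] [HasShift C ℤ]
  [∀ n : ℤ, (shiftFunctor C n).Additive] [Pretriangulated C]
  [Preadditive D] [HasZeroObject D] [HasShift D ℤ]
  [∀ n : ℤ, (shiftFunctor D n).Additive] [Pretriangulated D]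

/-- A functor between triangulated categories is exact if, for a suitable isomorphism of
commutation with the suspension, it preserves distinguished triangles. -/
def IsExactFunctor (F : C ⥤ D) : Prop :=
  ∃ _ : F.CommShift ℤ, F.IsTriangulated

end Exact

/-- Compatibility between a triangulation and a monoidal structure: the functors `a ⊗ -` and
`- ⊗ b` are exact, their commutations with the suspension are natural in both variables,
and the two ways from `T a ⊗ T b` to `T² (a ⊗ b)` differ by the sign `-1` (this is part of
`CommShift₂Int`). -/
class TensorTriangulated (K : Type u) [Category.{v} K] [Preadditive K] [HasZeroObject K]
    [HasShift K ℤ] [∀ n : ℤ, (shiftFunctor K n).Additive] [Pretriangulated K]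
    [MonoidalCategory K] where
  /-- commutation of the tensor product with the suspension in both variables -/
  commShift : (curriedTensor K).CommShift₂Int
  exact_left (a : K) : ((curriedTensor K).obj a).IsTriangulated
  exact_right (b : K) : ((curriedTensor K).flip.obj b).IsTriangulated

section StronglyClosed

variable {K : Type u} [Category.{v} K] [MonoidalCategory K]

/-- The natural morphism `D(a) ⊗ b ⟶ hom(a, b)`, where `D(a) = hom(a, 𝟙)`: it corresponds to
evaluation `a ⊗ (D(a) ⊗ b) ≅ (a ⊗ D(a)) ⊗ b ⟶ 𝟙 ⊗ b ≅ b`. -/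
def dualTensorToHom [MonoidalClosed K] (a b : K) :
    (ihom a).obj (𝟙_ K) ⊗ b ⟶ (ihom a).obj b :=
  MonoidalClosed.curry
    ((α_ a ((ihom a).obj (𝟙_ K)) b).inv ≫ ((ihom.ev a).app (𝟙_ K) ▷ b) ≫ (λ_ b).hom)

open CategoryTheory.Pretriangulated.Opposite in
/-- `K` is strongly closed: there is an internal hom functor `Kᵒᵖ × K ⥤ K`, exact in each
variable, and all objects are strongly dualizable. -/
def IsStronglyClosed (K : Type u) [Category.{v} K] [Preadditive K] [HasZeroObject K]
    [HasShift K ℤ] [∀ n : ℤ, (shiftFunctor K n).Additive] [Pretriangulated K]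
    [MonoidalCategory K] : Prop :=
  ∃ _ : MonoidalClosed K,
    (∀ b : K, IsExactFunctor (ihom b)) ∧
    (∀ c : K, IsExactFunctor (MonoidalClosed.internalHom.flip.obj c : Kᵒᵖ ⥤ K)) ∧
    ∀ a b : K, IsIso (dualTensorToHom a b)

end StronglyClosed

/-! ### The spectrum -/

section Spectrum

variable (K : Type u) [Category.{v} K] [Preadditive K] [HasZeroObject K]
  [HasShift K ℤ] [∀ n : ℤ, (shiftFunctor K n).Additive] [Pretriangulated K]
  [MonoidalCategory K]

/-- The spectrum of `K`: the prime ideals of `K`, i.e. the proper (strictly full) triangulated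
subcategories that are thick, tensor ideals and prime. -/
structure Spc where
  /-- the objects of the prime -/
  carrier : ObjectProperty K
  isTriangulated : carrier.IsTriangulated
  isClosedUnderIsomorphisms : carrier.IsClosedUnderIsomorphisms
  thick (a b : K) : carrier (a ⊞ b) → carrier a ∧ carrier b
  tensor_mem (a b : K) : carrier a → carrier (a ⊗ b)
  prime (a b : K) : carrier (a ⊗ b) → carrier a ∨ carrier b
  proper : ∃ a : K, ¬ carrier a

variable {K}

/-- The support `{P | a ∉ P}` of an object. -/
def supp (a : K) : Set (Spc K) := {P | ¬ P.carrier a}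

/-- The Zariski topology: the complements of the supports of objects form a basis. -/
instance : TopologicalSpace (Spc K) :=
  TopologicalSpace.generateFrom {s | ∃ a : K, s = (supp a)ᶜ}

/-- The full subcategory `K_Y` of objects supported on `Y`. -/
def supportedOn (Y : Set (Spc K)) : ObjectProperty K := fun a => supp a ⊆ Y

lemma supportedOn_mono {Y Y' : Set (Spc K)} (h : Y ⊆ Y') :
    supportedOn Y ≤ supportedOn Y' := fun _ ha => ha.trans h

/-! ### The categories over an open subset and the restriction functors -/

/-- The morphisms of `K` whose cone is supported on the complement of `U`. -/
abbrev isoOver (U : Opens (Spc K)) : MorphismProperty K :=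
  (supportedOn ((U : Set (Spc K))ᶜ)).trW

lemma isoOver_mono {U V : Opens (Spc K)} (h : V ≤ U) : isoOver U ≤ isoOver V :=
  ObjectProperty.trW_monotone (supportedOn_mono (Set.compl_subset_compl.2 h))

/-- The Verdier quotient `L(U) = K / K_Z`, with `Z` the complement of `U`. -/
abbrev LOver (U : Opens (Spc K)) := (isoOver U).Localization

/-- `K(U)`: the idempotent completion of the Verdier quotient `L(U)`. -/
abbrev KOver (U : Opens (Spc K)) := Idempotents.Karoubi (LOver U)

/-- The localization functor `L(U) ⥤ L(V)` for `V ⊆ U`. -/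
noncomputable def resL {U V : Opens (Spc K)} (h : V ≤ U) : LOver U ⥤ LOver V :=
  Localization.Construction.lift (isoOver V).Q
    (fun _ _ f hf => (isoOver V).Q_inverts f (isoOver_mono h f hf))

/-- The restriction functor `K(U) ⥤ K(V)` for `V ⊆ U`, induced by `L(U) ⥤ L(V)`. -/
noncomputable def res {U V : Opens (Spc K)} (h : V ≤ U) : KOver U ⥤ KOver V :=
  (Idempotents.functorExtension₂ (LOver U) (LOver V)).obj (resL h)

/-- The restriction functor `K ⥤ K(U)`: localization followed by idempotent completion. -/
noncomputable def rho (U : Opens (Spc K)) : K ⥤ KOver U :=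
  (isoOver U).Q ⋙ Idempotents.toKaroubi (LOver U)

lemma Q_comp_resL {U V : Opens (Spc K)} (h : V ≤ U) :
    (isoOver U).Q ⋙ resL h = (isoOver V).Q :=
  Localization.Construction.fac _ _

lemma resL_comp {U V W : Opens (Spc K)} (hV : V ≤ U) (hW : W ≤ V) :
    resL hV ⋙ resL hW = resL (hW.trans hV) := by
  apply Localization.Construction.uniq
  rw [← Functor.assoc, Q_comp_resL, Q_comp_resL, Q_comp_resL]

/-- Restriction is transitive. -/
lemma res_comp {U V W : Opens (Spc K)} (hV : V ≤ U) (hW : W ≤ V) :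
    res hV ⋙ res hW = res (hW.trans hV) := by
  unfold res
  rw [← resL_comp hV hW]
  rfl

lemma toKaroubi_comp {C D : Type*} [Category* C] [Category* D] (F : C ⥤ D) :
    Idempotents.toKaroubi C ⋙ (Idempotents.functorExtension₂ C D).obj F =
      F ⋙ Idempotents.toKaroubi D := by
  refine CategoryTheory.Functor.ext
    (fun X => Idempotents.Karoubi.ext rfl ?_) (fun X Y f => ?_)
  · exact (Category.comp_id _).trans ((F.map_id X).trans (Category.id_comp _).symm)
  · ext
    simp only [Idempotents.Karoubi.comp_f, Idempotents.Karoubi.eqToHom_f]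
    change F.map f = (F.map (𝟙 X) ≫ 𝟙 _) ≫ F.map f ≫ 𝟙 _ ≫ 𝟙 _
    simp

/-- Restriction from `K` is transitive. -/
lemma rho_comp {U V : Opens (Spc K)} (h : V ≤ U) : rho U ⋙ res h = rho V := by
  unfold rho res
  rw [Functor.assoc, toKaroubi_comp, ← Functor.assoc, Q_comp_resL]

/-- The identification of the two restrictions `K(U) ⥤ K(V) ⥤ K(W)` and `K(U) ⥤ K(W)`. -/
noncomputable def resCompIso {U V W : Opens (Spc K)} (hV : V ≤ U) (hW : W ≤ V) :
    res hV ⋙ res hW ≅ res (hW.trans hV) :=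
  eqToIso (res_comp hV hW)

/-- The identification of the two restrictions `K ⥤ K(U) ⥤ K(V)` and `K ⥤ K(V)`. -/
noncomputable def rhoCompIso {U V : Opens (Spc K)} (h : V ≤ U) : rho U ⋙ res h ≅ rho V :=
  eqToIso (rho_comp h)

/-- The restriction to `W` of an isomorphism over `V` between an object over `U` and
an object over `U'`, where `W ⊆ V ⊆ U ∩ U'`. -/
noncomputable def restrictIso {U U' V W : Opens (Spc K)} {hU : V ≤ U} {hU' : V ≤ U'}
    {a : KOver U} {b : KOver U'} (σ : (res hU).obj a ≅ (res hU').obj b) (hW : W ≤ V) :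
    (res (hW.trans hU)).obj a ≅ (res (hW.trans hU')).obj b :=
  ((resCompIso hU hW).app a).symm ≪≫ (res hW).mapIso σ ≪≫ (resCompIso hU' hW).app b

/-- The restriction to `V` of an isomorphism over `U` between an object `a` of `K` and
an object over `U`, where `V ⊆ U`. -/
noncomputable def restrictGlobalIso {U V : Opens (Spc K)} {a : K} {b : KOver U}
    (f : (rho U).obj a ≅ b) (h : V ≤ U) : (rho V).obj a ≅ (res h).obj b :=
  ((rhoCompIso h).app a).symm ≪≫ (res h).mapIso f

end Spectrum

end TTGeometry

namespace TTGeometry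

/-! ### Verdier localization with respect to two subcategories -/

section Verdier

open CategoryTheory.Pretriangulated CategoryTheory.Triangulated ZeroObject

variable {C : Type*} [Category* C] [Preadditive C] [HasZeroObject C] [HasShift C ℤ]
  [∀ n : ℤ, (shiftFunctor C n).Additive] [Pretriangulated C]

section TwoOutOfThree

variable [IsTriangulated C] {P : ObjectProperty C} [P.IsTriangulated]
  [P.IsClosedUnderIsomorphisms]

/-! Let `A` and `B` be the objects supported off U and off V. A denominator over U ∪ V has its cone
in A ∩ B; one over U ∩ V has its cone in the thick closure of the extensions of A and B
(`supportedOn_union`, which rests on the existence of primes). Strong dualizability makes every map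
between an object of A and an object of B factor through A ∩ B (`exists_factorization_thickIdeal`).
Hence extensions can be taken in either order, and octahedra and homotopy pushouts glue morphisms
(`exists_hom`) and, up to a direct summand over U, objects (`exists_object`). Gluing of morphisms is
existence without uniqueness. However, a composite f ≫ g vanishes over U ∪ V when f vanishes over U
and g over V (`comp_eq_zero_of_rs_eq_zero`), so glued idempotents and glued inverses are correct up
to square-zero errors, which polynomial formulas remove. This gives gluing of two objects and of
isomorphisms in the idempotent completions (`exists_idem_object`, `exists_idemIso`). For three
objects, glue a₁ and a₂ along σ₁₂ over U₁ ∪ U₂. On U₁ ∩ U₃ and U₂ ∩ U₃ the maps σ₁₃ and σ₂₃ identify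
a₃ with the result; by the cocycle relation they agree on the triple intersection, so they glue to
some isomorphism over (U₁ ∪ U₂) ∩ U₃. Any choice serves to glue with a₃, because only its
restrictions to the two pieces are prescribed. Over the whole spectrum denominators are isomorphisms
and idempotents split, so the glued object lies in K. -/

lemma trW_of_comp_left {X Y Z : C} {f : X ⟶ Y} {g : Y ⟶ Z} (h : P.trW (f ≫ g))
    (hf : P.trW f) : P.trW g := by
  obtain ⟨A, a, a', ha, hA⟩ := hf
  obtain ⟨B, b, b', hb, hB⟩ := h
  obtain ⟨D, d, d', hd⟩ := distinguished_cocone_triangle g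
  exact ⟨D, d, d', hd, P.ext_of_isTriangulatedClosed₃ _
    (someOctahedron rfl ha hd hb).mem hA hB⟩

lemma trW_of_comp_right {X Y Z : C} {f : X ⟶ Y} {g : Y ⟶ Z} (h : P.trW (f ≫ g))
    (hg : P.trW g) : P.trW f := by
  obtain ⟨A, a, a', ha, hA⟩ := hg
  obtain ⟨B, b, b', hb, hB⟩ := h
  obtain ⟨D, d, d', hd⟩ := distinguished_cocone_triangle f
  exact ⟨D, d, d', hd, P.ext_of_isTriangulatedClosed₁ _
    (someOctahedron rfl hd ha hb).mem hB hA⟩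

end TwoOutOfThree

/-- Cones are unique up to isomorphism, so one and the same cone lies in both subcategories. -/
lemma trW_inf {P Q : ObjectProperty C} [P.IsClosedUnderIsomorphisms] {X Y : C} {f : X ⟶ Y}
    (hP : P.trW f) (hQ : Q.trW f) : (P ⊓ Q).trW f := by
  obtain ⟨Z, g, h, hT, hZ⟩ := hQ
  exact ⟨Z, g, h, hT, (P.trW_iff_of_distinguished _ hT).1 hP, hZ⟩

section Pushout

variable [IsTriangulated C] {A B : ObjectProperty C} [A.IsStableUnderShift ℤ]

/-- Homotopy pushouts: the two pushed out morphisms have the same cones as the original ones,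
and the square is weakly universal. -/
lemma exists_homotopyPushout {E X₁ X₂ : C} {p₁ : E ⟶ X₁} {p₂ : E ⟶ X₂}
    (h₁ : B.trW p₁) (h₂ : A.trW p₂) :
    ∃ (Y : C) (v₁ : X₁ ⟶ Y) (v₂ : X₂ ⟶ Y), p₁ ≫ v₁ = p₂ ≫ v₂ ∧ A.trW v₁ ∧ B.trW v₂ ∧
      ∀ (Z : C) (x₁ : X₁ ⟶ Z) (x₂ : X₂ ⟶ Z), p₁ ≫ x₁ = p₂ ≫ x₂ →
        ∃ s : Y ⟶ Z, v₁ ≫ s = x₁ ∧ v₂ ≫ s = x₂ := by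
  obtain ⟨F, i, δ, hF, hFA⟩ := (A.trW_iff' p₂).1 h₂
  obtain ⟨G, a, a', hG, hGB⟩ := h₁
  obtain ⟨Y, v₁, w, hY⟩ := distinguished_cocone_triangle (i ≫ p₁)
  have o := someOctahedron rfl hF hG hY
  refine ⟨Y, v₁, o.m₁, o.comm₁.symm, (A.trW_iff' v₁).2 ⟨_, _, _, hY, hFA⟩,
    ⟨_, _, _, o.mem, hGB⟩, fun Z x₁ x₂ h => ?_⟩
  have hi : i ≫ p₂ = 0 := comp_distTriang_mor_zero₁₂ _ hF
  have hw : v₁ ≫ w = 0 := comp_distTriang_mor_zero₂₃ _ hY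
  obtain ⟨s, hs⟩ : ∃ s : Y ⟶ Z, x₁ = v₁ ≫ s := Triangle.yoneda_exact₂ _ hY x₁ (by
    change (i ≫ p₁) ≫ x₁ = 0
    rw [Category.assoc, h, reassoc_of% hi, zero_comp])
  -- `s` is right on X₁ only; its error on X₂ vanishes on E, hence factors through δ. Since v₂ ≫ w =
  -- δ and v₁ ≫ w = 0, adding w ≫ t corrects it without disturbing v₁.
  obtain ⟨t, ht⟩ : ∃ t : F⟦(1 : ℤ)⟧ ⟶ Z, x₂ - o.m₁ ≫ s = δ ≫ t :=
    Triangle.yoneda_exact₃ _ hF (x₂ - o.m₁ ≫ s) (by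
      change p₂ ≫ (x₂ - o.m₁ ≫ s) = 0
      rw [Preadditive.comp_sub, o.comm₁_assoc, ← hs, h, sub_self])
  refine ⟨s + w ≫ t, ?_, ?_⟩
  · rw [Preadditive.comp_add, reassoc_of% hw, zero_comp, add_zero, hs]
  · rw [Preadditive.comp_add, o.comm₂_assoc, ← ht, add_sub_cancel]

end Pushout

lemma extensionProduct_self_le (P : ObjectProperty C) [P.IsTriangulated]
    [P.IsClosedUnderIsomorphisms] : P.extensionProduct P ≤ P :=
  ObjectProperty.extensionProduct_le_of_isTriangulatedClosed₂ le_rfl le_rfl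

/-- A morphism whose cone is an extension of `B` by `A` is the composition of a morphism with
cone in `A` and a morphism with cone in `B`. -/
lemma exists_factorization_of_trW_extensionProduct [IsTriangulated C]
    {A B : ObjectProperty C} {X Y : C} {s : X ⟶ Y}
    (hs : (A.extensionProduct B).trW s) :
    ∃ (Z : C) (p : X ⟶ Z) (q : Z ⟶ Y), p ≫ q = s ∧ A.trW p ∧ B.trW q := by
  obtain ⟨W, g, h, hT, E, F, a, b, c, hT', hE, hF⟩ := hs
  obtain ⟨Z, q, w, hZ⟩ := distinguished_cocone_triangle₁ (g ≫ b)
  have o := someOctahedron' rfl hT hT' hZ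
  exact ⟨Z, o.m₁, q, o.comm₁, ⟨_, _, _, o.mem, hE⟩, ⟨_, _, _, hZ, hF⟩⟩

lemma retractClosure_isTriangulated (P : ObjectProperty C) [P.IsTriangulated]
    [P.IsClosedUnderIsomorphisms] : P.retractClosure.IsTriangulated where
  toContainsZero := ⟨0, isZero_zero C, P.le_retractClosure 0 P.prop_zero⟩
  isStableUnderShiftBy n := ⟨by
    rintro X ⟨Y, hY, ⟨r⟩⟩
    exact ⟨_, P.le_shift n _ hY, ⟨r.map (shiftFunctor C n)⟩⟩⟩
  ext₂' T hT h₁ h₃ := by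
    apply ObjectProperty.le_isoClosure
    exact ObjectProperty.monotone_retractClosure (extensionProduct_self_le P) _
      (ObjectProperty.extensionProduct_retractClosure_retractClosure_le P P _
        ⟨_, _, _, _, _, hT, h₁, h₃⟩)

/-- A morphism with cone a retract of an object of `P` has cone in `P` after precomposition with
a retraction. -/
lemma exists_retraction_trW_comp (P : ObjectProperty C) {X Y : C} {s : X ⟶ Y}
    (hs : P.retractClosure.trW s) :
    ∃ (X' : C) (j : X ⟶ X') (r : X' ⟶ X), j ≫ r = 𝟙 X ∧ P.trW (r ≫ s) := by
  obtain ⟨W, g, h, hT, D, hD, ⟨i, ρ, hi⟩⟩ := hs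
  obtain ⟨X', t, w, hT'⟩ := distinguished_cocone_triangle₁ (g ≫ i)
  obtain ⟨j, hj₁, hj₃⟩ : ∃ j : X ⟶ X', s ≫ 𝟙 Y = j ≫ t ∧ h ≫ j⟦(1 : ℤ)⟧' = i ≫ w :=
    complete_distinguished_triangle_morphism₁ _ _ hT hT' (𝟙 Y) i (Category.id_comp _).symm
  obtain ⟨r, hr₁, hr₃⟩ : ∃ r : X' ⟶ X, t ≫ 𝟙 Y = r ≫ s ∧ w ≫ r⟦(1 : ℤ)⟧' = ρ ≫ h :=
    complete_distinguished_triangle_morphism₁ _ _ hT' hT (𝟙 Y) ρ (by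
      change (g ≫ i) ≫ ρ = 𝟙 Y ≫ g
      rw [Category.assoc, hi, Category.comp_id, Category.id_comp])
  rw [Category.comp_id] at hj₁ hr₁
  let φ : Triangle.mk s g h ⟶ Triangle.mk s g h :=
    Triangle.homMk _ _ (j ≫ r) (𝟙 Y) (𝟙 W)
      (by change s ≫ 𝟙 Y = (j ≫ r) ≫ s; rw [Category.assoc, ← hr₁, ← hj₁, Category.comp_id])
      (by change g ≫ 𝟙 W = 𝟙 Y ≫ g; simp)
      (by
        change h ≫ (j ≫ r)⟦(1 : ℤ)⟧' = 𝟙 W ≫ h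
        rw [Functor.map_comp, reassoc_of% hj₃, hr₃, reassoc_of% hi, Category.id_comp])
  -- Fill-ins of triangles are not unique, so j ≫ r need not be the identity; it is invertible by
  -- the five lemma, and j is corrected by its inverse.
  have : IsIso (j ≫ r) := isIso₁_of_isIso₂₃ φ hT hT
    (inferInstanceAs (IsIso (𝟙 Y))) (inferInstanceAs (IsIso (𝟙 W)))
  exact ⟨X', inv (j ≫ r) ≫ j, r, by simp, D, _, _, by rw [← hr₁]; exact hT', hD⟩

section ExtensionProduct

variable [IsTriangulated C] {A B : ObjectProperty C} [A.IsTriangulated] [B.IsTriangulated]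
  [A.IsClosedUnderIsomorphisms] [B.IsClosedUnderIsomorphisms]

/-- The connecting map Z ⟶ Y⟦1⟧ of the extension factors through A ∩ B. The octahedron on this
factorization presents X⟦1⟧ as an extension in the other order. -/
lemma extensionProduct_swap_le [A.IsVerdierLeftLocalizing B] :
    B.extensionProduct A ≤ A.extensionProduct B := by
  rintro X ⟨Y, Z, f, g, h, hT, hY, hZ⟩
  have hY' : B (Y⟦(1 : ℤ)⟧) := B.le_shift (1 : ℤ) _ hY
  obtain ⟨W, c, d, hWA, hWB, fac⟩ :=
    ObjectProperty.IsVerdierLeftLocalizing.fac h hZ hY'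
  obtain ⟨E₁, a₁, b₁, h₁⟩ := distinguished_cocone_triangle c
  obtain ⟨E₂, a₂, b₂, h₂⟩ := distinguished_cocone_triangle d
  have o := someOctahedron fac h₁ h₂ (rot_of_distTriang _ (rot_of_distTriang _ hT))
  have hE₁ : A E₁ := A.ext_of_isTriangulatedClosed₃ _ h₁ hZ hWA
  have hE₂ : B E₂ := B.ext_of_isTriangulatedClosed₃ _ h₂ hWB hY'
  have : A.extensionProduct B (X⟦(1 : ℤ)⟧) := ⟨_, _, _, _, _, o.mem, hE₁, hE₂⟩
  exact ((A.extensionProduct B).prop_shift_iff_of_isStableUnderShift X (1 : ℤ)).1 this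

lemma extensionProduct_comm [A.IsVerdierLeftLocalizing B] [A.IsVerdierRightLocalizing B] :
    A.extensionProduct B = B.extensionProduct A := by
  have : B.IsVerdierLeftLocalizing A := ⟨fun f hX hY => by
    obtain ⟨Z, a, b, h₁, h₂, fac⟩ := ObjectProperty.IsVerdierRightLocalizing.fac (A := A) f hX hY
    exact ⟨Z, a, b, h₂, h₁, fac⟩⟩
  exact le_antisymm extensionProduct_swap_le extensionProduct_swap_le

/-- Writing * for extensions, (A*B)*(A*B) = A*(B*A)*B ⊆ A*(A*B)*B = (A*A)*(B*B) ⊆ A*B. -/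
lemma extensionProduct_isTriangulated [A.IsVerdierLeftLocalizing B] :
    (A.extensionProduct B).IsTriangulated where
  toContainsZero := ⟨0, isZero_zero C, ObjectProperty.le_extensionProduct_left B 0 A.prop_zero⟩
  ext₂' T hT h₁ h₃ := by
    apply ObjectProperty.le_isoClosure
    have h : (A.extensionProduct B).extensionProduct (A.extensionProduct B) T.obj₂ :=
      ⟨_, _, _, _, _, hT, h₁, h₃⟩
    rw [ObjectProperty.extensionProduct_assoc, ← ObjectProperty.extensionProduct_assoc B A B] at h
    have h' := ObjectProperty.monotone_extensionProduct_right A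
      (ObjectProperty.monotone_extensionProduct_left B
        (extensionProduct_swap_le (A := A) (B := B))) _ h
    rw [ObjectProperty.extensionProduct_assoc A B B, ← ObjectProperty.extensionProduct_assoc] at h'
    exact ObjectProperty.monotone_extensionProduct_left _ (extensionProduct_self_le A) _
      (ObjectProperty.monotone_extensionProduct_right _ (extensionProduct_self_le B) _ h')

variable [A.IsVerdierLeftLocalizing B] [A.IsVerdierRightLocalizing B]

/-- Two fractions with denominators in `A` and `B` which agree modulo `A` and `B` come from a
common fraction. -/
lemma exists_common_fraction {X Y D₁ D₂ E : C} {s₁ : D₁ ⟶ X} {g₁ : D₁ ⟶ Y} {s₂ : D₂ ⟶ X}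
    {g₂ : D₂ ⟶ Y} {t₁ : E ⟶ D₁} {t₂ : E ⟶ D₂} (hs₁ : A.trW s₁) (hs₂ : B.trW s₂)
    (hs : t₁ ≫ s₁ = t₂ ≫ s₂) (hg : t₁ ≫ g₁ = t₂ ≫ g₂)
    (h : (A.extensionProduct B).retractClosure.trW (t₁ ≫ s₁)) :
    ∃ (F : C) (s : F ⟶ X) (g : F ⟶ Y), (A ⊓ B).trW s ∧
      (∃ (D : C) (q : D ⟶ D₁) (v : D ⟶ F), A.trW q ∧ v ≫ s = q ≫ s₁ ∧ v ≫ g = q ≫ g₁) ∧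
      (∃ (D : C) (q : D ⟶ D₂) (v : D ⟶ F), B.trW q ∧ v ≫ s = q ≫ s₂ ∧ v ≫ g = q ≫ g₂) := by
  have := extensionProduct_isTriangulated (A := A) (B := B)
  -- Passing to E' turns a cone which is only a retract of an extension into a genuine extension,
  -- which can be factored.
  obtain ⟨E', -, r, -, hr⟩ := exists_retraction_trW_comp _ h
  have h₁ : (A.extensionProduct B).trW (r ≫ t₁) :=
    trW_of_comp_right (by rwa [Category.assoc])
      (ObjectProperty.trW_monotone (ObjectProperty.le_extensionProduct_left B) _ hs₁)
  have h₂ : (A.extensionProduct B).trW (r ≫ t₂) :=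
    trW_of_comp_right (by rwa [Category.assoc, ← hs])
      (ObjectProperty.trW_monotone (ObjectProperty.le_extensionProduct_right A) _ hs₂)
  -- The two factorizations are taken in opposite orders: p₁ has cone in B and p₂ in A. The pushed
  -- out v₁ then has cone in A and v₂ in B, and two-out-of-three puts the cone of s in both.
  rw [extensionProduct_comm] at h₁
  obtain ⟨D, p₁, q₁, hpq₁, hp₁, hq₁⟩ := exists_factorization_of_trW_extensionProduct h₁
  obtain ⟨D', p₂, q₂, hpq₂, hp₂, hq₂⟩ := exists_factorization_of_trW_extensionProduct h₂
  obtain ⟨F, v₁, v₂, -, hv₁, hv₂, H⟩ := exists_homotopyPushout hp₁ hp₂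
  obtain ⟨s, hsv₁, hsv₂⟩ := H X (q₁ ≫ s₁) (q₂ ≫ s₂) (by
    rw [reassoc_of% hpq₁, reassoc_of% hpq₂, hs])
  obtain ⟨g, hgv₁, hgv₂⟩ := H Y (q₁ ≫ g₁) (q₂ ≫ g₂) (by
    rw [reassoc_of% hpq₁, reassoc_of% hpq₂, hg])
  refine ⟨F, s, g, trW_inf (trW_of_comp_left (f := v₁) ?_ hv₁)
    (trW_of_comp_left (f := v₂) ?_ hv₂), ⟨D, q₁, v₁, hq₁, hsv₁, hgv₁⟩,
    ⟨D', q₂, v₂, hq₂, hsv₂, hgv₂⟩⟩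
  · rw [hsv₁]
    exact A.trW.comp_mem _ _ hq₁ hs₁
  · rw [hsv₂]
    exact B.trW.comp_mem _ _ hq₂ hs₂

/-- The gluing construction: two objects related by a fraction whose cones are generated by
`A` and `B` are, after enlarging the first one, isomorphic modulo `A` and modulo `B`
respectively to a common object. -/
lemma exists_common_object {X₁ X₂ D : C} {s : D ⟶ X₁} {t : D ⟶ X₂}
    (hs : (A.extensionProduct B).trW s) (ht : (A.extensionProduct B).retractClosure.trW t) :
    ∃ (X E D₁ D₂ Y : C) (κ : X₁ ⟶ X) (ρ : X ⟶ X₁) (j : D ⟶ E) (r : E ⟶ D)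
      (p₁ : E ⟶ D₁) (q₁ : D₁ ⟶ X) (p₂ : E ⟶ D₂) (q₂ : D₂ ⟶ X₂) (v₁ : D₁ ⟶ Y) (v₂ : D₂ ⟶ Y),
      κ ≫ ρ = 𝟙 X₁ ∧ j ≫ r = 𝟙 D ∧ s ≫ κ = j ≫ p₁ ≫ q₁ ∧ p₁ ≫ q₁ ≫ ρ = r ≫ s ∧
      p₂ ≫ q₂ = r ≫ t ∧ p₁ ≫ v₁ = p₂ ≫ v₂ ∧ A.trW q₁ ∧ B.trW p₁ ∧ A.trW p₂ ∧ B.trW q₂ ∧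
      A.trW v₁ ∧ B.trW v₂ := by
  obtain ⟨E, j, r, hjr, hr⟩ := exists_retraction_trW_comp _ ht
  have hj : (⊤ : ObjectProperty C).trW j := by
    obtain ⟨_, _, _, h⟩ := distinguished_cocone_triangle j
    exact ⟨_, _, _, h, trivial⟩
  have : (⊤ : ObjectProperty C).IsStableUnderShift ℤ := ⟨fun n => ⟨fun _ _ => trivial⟩⟩
  -- Replacing D by the larger E requires extending s to E. Pushing s out along j does this with the
  -- same cone, and weak universality retracts the new target X onto X₁.
  obtain ⟨X, κ, s', hκ, -, hs', H⟩ := exists_homotopyPushout hs hj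
  obtain ⟨ρ, hρ, hρ'⟩ := H X₁ (𝟙 _) (r ≫ s) (by rw [reassoc_of% hjr, Category.comp_id])
  rw [extensionProduct_comm] at hs'
  obtain ⟨D₁, p₁, q₁, hpq₁, hp₁, hq₁⟩ := exists_factorization_of_trW_extensionProduct hs'
  obtain ⟨D₂, p₂, q₂, hpq₂, hp₂, hq₂⟩ := exists_factorization_of_trW_extensionProduct hr
  obtain ⟨Y, v₁, v₂, hv, hv₁, hv₂, -⟩ := exists_homotopyPushout hp₁ hp₂
  exact ⟨X, E, D₁, D₂, Y, κ, ρ, j, r, p₁, q₁, p₂, q₂, v₁, v₂, hρ, hjr, by rw [hpq₁, hκ],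
    by rw [reassoc_of% hpq₁, hρ'], hpq₂, hv, hq₁, hp₁, hp₂, hq₂, hv₁, hv₂⟩

end ExtensionProduct

end Verdier

/-! ### Thick tensor ideals and supports -/

section Retract

open CategoryTheory.Pretriangulated

variable {C : Type*} [Category* C] [Preadditive C] [HasZeroObject C] [HasShift C ℤ]
  [∀ n : ℤ, (shiftFunctor C n).Additive] [Pretriangulated C]

/-- In a pretriangulated category, retracts are direct factors. -/
lemma exists_iso_biprod_of_retract {X Y : C} (r : Retract X Y) :
    ∃ Z : C, Nonempty (Y ≅ X ⊞ Z) := by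
  obtain ⟨Z, g, h, hT⟩ := distinguished_cocone_triangle r.i
  have hh : h = 0 := by
    have h₀ : h ≫ r.i⟦(1 : ℤ)⟧' = 0 := comp_distTriang_mor_zero₃₁ _ hT
    exact (cancel_mono (r.i⟦(1 : ℤ)⟧')).1 (h₀.trans zero_comp.symm)
  obtain ⟨e, -, -⟩ := exists_iso_binaryBiproduct_of_distTriang _ hT hh
  exact ⟨Z, ⟨e⟩⟩

end Retract

open ZeroObject

variable {K : Type u} [Category.{v} K] [Preadditive K] [HasZeroObject K]
  [HasShift K ℤ] [∀ n : ℤ, (shiftFunctor K n).Additive] [Pretriangulated K]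
  [MonoidalCategory K]

/-- Thick triangulated tensor ideals. -/
structure IsThickIdeal (P : ObjectProperty K) : Prop where
  isTriangulated : P.IsTriangulated
  isStableUnderRetracts : P.IsStableUnderRetracts
  tensor_mem (a b : K) : P a → P (a ⊗ b)

lemma IsThickIdeal.isClosedUnderIsomorphisms {P : ObjectProperty K} (hP : IsThickIdeal P) :
    P.IsClosedUnderIsomorphisms :=
  have := hP.isStableUnderRetracts
  inferInstance

lemma Spc.isThickIdeal (P : Spc K) : IsThickIdeal P.carrier where
  isTriangulated := P.isTriangulated
  isStableUnderRetracts := ⟨fun {X Y} r hY => by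
    have := P.isClosedUnderIsomorphisms
    obtain ⟨Z, ⟨e⟩⟩ := exists_iso_biprod_of_retract r
    exact (P.thick X Z (P.carrier.prop_of_iso e hY)).1⟩
  tensor_mem := P.tensor_mem

lemma isThickIdeal_supportedOn (Y : Set (Spc K)) : IsThickIdeal (supportedOn Y) where
  isTriangulated :=
    have : (supportedOn Y).IsClosedUnderIsomorphisms := ⟨fun e h P hP =>
      have := P.isClosedUnderIsomorphisms
      h fun hX => hP (P.carrier.prop_of_iso e hX)⟩
    { exists_zero := ⟨0, isZero_zero K, fun P hP =>
        have := P.isTriangulated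
        have := P.isClosedUnderIsomorphisms
        (hP P.carrier.prop_zero).elim⟩
      isStableUnderShiftBy := fun n => ⟨fun X hX P hP => hX fun h =>
        have := P.isTriangulated
        hP (P.carrier.le_shift n _ h)⟩
      ext₂' := fun T hT h₁ h₃ => ObjectProperty.le_isoClosure _ _ fun P hP => by
        by_contra hPY
        have := P.isTriangulated
        have := P.isClosedUnderIsomorphisms
        exact hP (P.carrier.ext_of_isTriangulatedClosed₂ T hT
          (by_contra fun h => hPY (h₁ h)) (by_contra fun h => hPY (h₃ h))) }
  isStableUnderRetracts := ⟨fun r h P hP => h fun hY =>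
    have := P.isThickIdeal.isStableUnderRetracts
    hP (P.carrier.prop_of_retract r hY)⟩
  tensor_mem a b h P hP := h fun ha => hP (P.tensor_mem a b ha)

instance (Y : Set (Spc K)) : (supportedOn Y).IsTriangulated :=
  (isThickIdeal_supportedOn Y).isTriangulated

instance (Y : Set (Spc K)) : (supportedOn Y).IsStableUnderRetracts :=
  (isThickIdeal_supportedOn Y).isStableUnderRetracts

lemma IsThickIdeal.tensor_mem' [BraidedCategory K] {P : ObjectProperty K} (hP : IsThickIdeal P)
    (a b : K) (hb : P b) : P (a ⊗ b) :=
  have := hP.isClosedUnderIsomorphisms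
  P.prop_of_iso (β_ b a) (hP.tensor_mem b a hb)

lemma isThickIdeal_iUnion_of_isChain {c : Set (ObjectProperty K)} (hc : IsChain (· ≤ ·) c)
    (hne : c.Nonempty) (h : ∀ P ∈ c, IsThickIdeal P) :
    IsThickIdeal (fun a => ∃ P ∈ c, P a) := by
  have : ObjectProperty.IsStableUnderRetracts (fun a : K => ∃ P ∈ c, P a) :=
    ⟨fun r ⟨P, hPc, hP⟩ =>
      have := (h P hPc).isStableUnderRetracts
      ⟨P, hPc, P.prop_of_retract r hP⟩⟩
  refine ⟨?_, this, fun a b ⟨P, hPc, hP⟩ => ⟨P, hPc, (h P hPc).tensor_mem a b hP⟩⟩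
  refine { exists_zero := ?_, isStableUnderShiftBy := fun n => ⟨?_⟩, ext₂' := ?_ }
  · obtain ⟨P, hPc⟩ := hne
    have := (h P hPc).isTriangulated
    have := (h P hPc).isClosedUnderIsomorphisms
    exact ⟨0, isZero_zero K, P, hPc, P.prop_zero⟩
  · rintro X ⟨P, hPc, hP⟩
    have := (h P hPc).isTriangulated
    exact ⟨P, hPc, P.le_shift n _ hP⟩
  · rintro T hT ⟨P, hPc, hP⟩ ⟨Q, hQc, hQ⟩
    apply ObjectProperty.le_isoClosure
    obtain ⟨R, hRc, hPR, hQR⟩ : ∃ R ∈ c, P ≤ R ∧ Q ≤ R := by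
      rcases hc.total hPc hQc with hPQ | hQP
      · exact ⟨Q, hQc, hPQ, le_rfl⟩
      · exact ⟨P, hPc, le_rfl, hQP⟩
    have := (h R hRc).isTriangulated
    have := (h R hRc).isClosedUnderIsomorphisms
    exact ⟨R, hRc, R.ext_of_isTriangulatedClosed₂ T hT (hPR _ hP) (hQR _ hQ)⟩

/-! ### Consequences of strong dualizability -/

section Closed

/-- Every morphism `a ⟶ b` factors through an object in the tensor ideals generated by `a` and
by `b`. -/
lemma IsStronglyClosed.exists_factorization (hK : IsStronglyClosed K) {a b : K} (f : a ⟶ b) :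
    ∃ (d : K) (g : a ⟶ a ⊗ (d ⊗ b)) (h : a ⊗ (d ⊗ b) ⟶ b), g ≫ h = f := by
  obtain ⟨_, -, -, h⟩ := hK
  have := h a b
  -- With d the dual of a, f corresponds to a map 𝟙 ⟶ hom(a, b) ≅ d ⊗ b; tensoring it with a and
  -- then evaluating recovers f.
  refine ⟨(ihom a).obj (𝟙_ K),
    (ρ_ a).inv ≫ a ◁ (MonoidalClosed.curry ((ρ_ a).hom ≫ f) ≫ inv (dualTensorToHom a b)),
    a ◁ dualTensorToHom a b ≫ (ihom.ev a).app b, ?_⟩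
  rw [Category.assoc, ← MonoidalCategory.whiskerLeft_comp_assoc, Category.assoc,
    IsIso.inv_hom_id, Category.comp_id, ← MonoidalClosed.uncurry_eq,
    MonoidalClosed.uncurry_curry, Iso.inv_hom_id_assoc]

variable [BraidedCategory K]

lemma IsStronglyClosed.exists_factorization_thickIdeal (hK : IsStronglyClosed K)
    {P Q : ObjectProperty K}
    (hP : IsThickIdeal P) (hQ : IsThickIdeal Q) {a b : K} (f : a ⟶ b) (ha : P a) (hb : Q b) :
    ∃ (c : K) (g : a ⟶ c) (h : c ⟶ b), P c ∧ Q c ∧ g ≫ h = f := by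
  obtain ⟨d, g, h, fac⟩ := hK.exists_factorization f
  exact ⟨_, g, h, hP.tensor_mem _ _ ha, hQ.tensor_mem' _ _ (hQ.tensor_mem' _ _ hb), fac⟩

lemma IsStronglyClosed.isVerdierLeftLocalizing (hK : IsStronglyClosed K)
    {P Q : ObjectProperty K}
    (hP : IsThickIdeal P) (hQ : IsThickIdeal Q) : P.IsVerdierLeftLocalizing Q :=
  ⟨fun f ha hb => hK.exists_factorization_thickIdeal hP hQ f ha hb⟩

lemma IsStronglyClosed.isVerdierRightLocalizing (hK : IsStronglyClosed K)
    {P Q : ObjectProperty K}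
    (hP : IsThickIdeal P) (hQ : IsThickIdeal Q) : P.IsVerdierRightLocalizing Q :=
  ⟨fun f ha hb => by
    obtain ⟨c, g, h, h₁, h₂, fac⟩ := hK.exists_factorization_thickIdeal hQ hP f ha hb
    exact ⟨c, g, h, h₂, h₁, fac⟩⟩

/-- Thick tensor ideals are radical. -/
lemma IsThickIdeal.of_tensor_self (hK : IsStronglyClosed K) {P : ObjectProperty K}
    (hP : IsThickIdeal P) {a : K} (h : P (a ⊗ a)) : P a := by
  have := hP.isStableUnderRetracts
  have := hP.isClosedUnderIsomorphisms
  -- Factoring the identity makes a a retract of a ⊗ (d ⊗ a), which is d ⊗ (a ⊗ a) up to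
  -- permutation.
  obtain ⟨d, g, h', fac⟩ := hK.exists_factorization (𝟙 a)
  refine P.prop_of_retract ⟨g, h', fac⟩ (P.prop_of_iso ?_ (hP.tensor_mem' d _ h))
  exact (α_ d a a).symm ≪≫ whiskerRightIso (β_ d a) a ≪≫ α_ a d a

end Closed

/-! ### Existence of primes -/

section Prime

variable [BraidedCategory K] [TensorTriangulated K]

/-- The ideal quotient of a thick tensor ideal by an object. -/
lemma IsThickIdeal.colon {P : ObjectProperty K} (hP : IsThickIdeal P) (b : K) :
    IsThickIdeal (fun a => P (a ⊗ b)) where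
  isTriangulated := by
    let _ := TensorTriangulated.commShift (K := K)
    have := TensorTriangulated.exact_right b
    have := hP.isTriangulated
    have := hP.isClosedUnderIsomorphisms
    exact inferInstanceAs (P.inverseImage ((curriedTensor K).flip.obj b)).IsTriangulated
  isStableUnderRetracts := ⟨fun r h =>
    have := hP.isStableUnderRetracts
    P.prop_of_retract (r.map (tensorRight b)) h⟩
  tensor_mem a c h := by
    have := hP.isClosedUnderIsomorphisms
    exact P.prop_of_iso (α_ a b c ≪≫ whiskerLeftIso a (β_ b c) ≪≫ (α_ a c b).symm)
      (hP.tensor_mem _ c h)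

/-- An object outside of a thick tensor ideal is outside of a prime containing this ideal. -/
lemma IsThickIdeal.exists_prime (hK : IsStronglyClosed K) {P : ObjectProperty K}
    (hP : IsThickIdeal P) {x : K} (hx : ¬ P x) :
    ∃ Q : Spc K, P ≤ Q.carrier ∧ ¬ Q.carrier x := by
  obtain ⟨M, hPM, hM⟩ := zorn_le_nonempty₀
    {Q : ObjectProperty K | IsThickIdeal Q ∧ ¬ Q x}
    (fun c hc hchain Q hQ => ⟨fun a => ∃ P ∈ c, P a,
      ⟨isThickIdeal_iUnion_of_isChain hchain ⟨Q, hQ⟩ fun P hP => (hc hP).1,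
        fun ⟨P, hPc, hP⟩ => (hc hPc).2 hP⟩,
      fun R hR a ha => ⟨R, hR, ha⟩⟩) P ⟨hP, hx⟩
  obtain ⟨hMI, hMx⟩ := hM.prop
  -- The quotient of M by b contains M and also a ∉ M, so by maximality it contains x. Using this
  -- twice gives x ⊗ x ∈ M, against radicality.
  have hmax {a b : K} (hab : M (a ⊗ b)) (ha : ¬ M a) : M (x ⊗ b) := by
    by_contra hxb
    exact ha (hM.le_of_ge (y := fun a => M (a ⊗ b)) ⟨hMI.colon b, hxb⟩
      (fun y hy => hMI.tensor_mem y b hy) a hab)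
  have := hMI.isStableUnderRetracts
  have := hMI.isClosedUnderIsomorphisms
  refine ⟨⟨M, hMI.isTriangulated, inferInstance,
    fun a b h => ⟨ObjectProperty.IsStableUnderRetracts.of_biprod_left M h,
      ObjectProperty.IsStableUnderRetracts.of_biprod_right M h⟩, hMI.tensor_mem, fun a b hab => ?_,
      ⟨x, hMx⟩⟩, hPM, hMx⟩
  by_contra! hab'
  have h₁ := hmax hab hab'.1
  exact hMx (IsThickIdeal.of_tensor_self hK hMI (hmax (M.prop_of_iso (β_ x b) h₁) hab'.2))

end Prime


/-! ### Supports and the topology of the spectrum -/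

section Support

lemma supp_biprod (a b : K) : supp (a ⊞ b) = supp a ∪ supp b := by
  ext P
  have := P.isTriangulated
  have := P.isClosedUnderIsomorphisms
  change (¬ P.carrier _) ↔ (¬ P.carrier _) ∨ (¬ P.carrier _)
  rw [← not_and_or, not_iff_not]
  exact ⟨P.thick a b, fun h => P.carrier.ext_of_isTriangulatedClosed₂ _
    (Pretriangulated.binaryBiproductTriangle_distinguished a b) h.1 h.2⟩

lemma supp_tensor [BraidedCategory K] (a b : K) : supp (a ⊗ b) = supp a ∩ supp b := by
  ext P
  change (¬ P.carrier _) ↔ (¬ P.carrier _) ∧ (¬ P.carrier _)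
  rw [← not_or, not_iff_not]
  exact ⟨P.prime a b, fun h => h.elim (P.isThickIdeal.tensor_mem a b)
    (P.isThickIdeal.tensor_mem' a b)⟩

lemma supp_unit : supp (𝟙_ K) = Set.univ := by
  refine Set.eq_univ_of_forall fun P h => ?_
  obtain ⟨a, ha⟩ := P.proper
  have := P.isClosedUnderIsomorphisms
  exact ha (P.carrier.prop_of_iso (λ_ a) (P.tensor_mem _ a h))

lemma supp_zero : supp (0 : K) = ∅ := by
  refine Set.eq_empty_of_forall_notMem fun P h => h ?_
  have := P.isTriangulated
  have := P.isClosedUnderIsomorphisms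
  exact P.carrier.prop_zero

variable (K) in
lemma isTopologicalBasis_compl_supp :
    IsTopologicalBasis (Set.range fun a : K => (supp a)ᶜ) := by
  have hr : (Set.range fun a : K => (supp a)ᶜ) = {s | ∃ a : K, s = (supp a)ᶜ} := by
    ext s
    exact exists_congr fun a => eq_comm
  have h := isTopologicalBasis_of_subbasis_of_inter (α := Spc K)
    (r := {s | ∃ a : K, s = (supp a)ᶜ}) rfl (by
      rintro _ ⟨a, rfl⟩ _ ⟨b, rfl⟩
      exact ⟨a ⊞ b, by rw [supp_biprod, Set.compl_union]⟩)
  have h₀ : (Set.univ : Set (Spc K)) ∈ {s | ∃ a : K, s = (supp a)ᶜ} :=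
    ⟨0, by rw [supp_zero, Set.compl_empty]⟩
  rwa [Set.insert_eq_of_mem h₀, ← hr] at h

/-- The complement of a quasi-compact open subset is the support of an object. -/
lemma exists_compl_eq_supp [BraidedCategory K] {U : Set (Spc K)} (hU : IsCompact U)
    (hU' : IsOpen U) : ∃ z : K, Uᶜ = supp z := by
  obtain ⟨s, hs, rfl⟩ := eq_finite_iUnion_of_isTopologicalBasis_of_isCompact_open _
    (isTopologicalBasis_compl_supp K) U hU hU'
  -- The complement is a finite intersection of supports, hence the support of a tensor product,
  -- with 𝟙 for the empty intersection.
  simp only [Set.compl_iUnion, compl_compl]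
  clear hU hU'
  induction s, hs using Set.Finite.induction_on with
  | empty => exact ⟨𝟙_ K, by simp [supp_unit]⟩
  | @insert a s _ hs ih =>
    obtain ⟨z, hz⟩ := ih
    exact ⟨a ⊗ z, by rw [supp_tensor, ← hz, Set.biInter_insert]⟩

end Support

/-! ### Objects supported on a union of two supports -/

section Decomposition

variable [TensorTriangulated K]

lemma isThickIdeal_isZero : IsThickIdeal (fun a : K => IsZero a) := by
  have h : ObjectProperty.IsStableUnderRetracts (fun a : K => IsZero a) :=
    ⟨fun r h => by
      rw [IsZero.iff_id_eq_zero, ← r.retract, h.eq_of_tgt r.i 0, zero_comp]⟩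
  refine ⟨{ exists_zero := ⟨0, isZero_zero K, isZero_zero K⟩,
            isStableUnderShiftBy := fun n => ⟨fun X hX => (shiftFunctor K n).map_isZero hX⟩,
            ext₂' := fun T hT h₁ h₃ => ObjectProperty.le_isoClosure _ _
              (Pretriangulated.Triangle.isZero₂_of_isZero₁₃ T hT h₁ h₃) }, h, fun a b ha => ?_⟩
  let _ := TensorTriangulated.commShift (K := K)
  have := TensorTriangulated.exact_right b
  exact ((curriedTensor K).flip.obj b).map_isZero ha

variable [BraidedCategory K]

/-- The zero objects form a thick ideal, so a nonzero object avoids some prime. -/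
lemma isZero_of_supp_eq_empty (hK : IsStronglyClosed K) {a : K} (h : supp a = ∅) : IsZero a := by
  by_contra ha
  obtain ⟨P, -, hP⟩ := isThickIdeal_isZero.exists_prime hK ha
  exact Set.notMem_empty P (h ▸ hP)

variable [IsTriangulated K]

lemma IsThickIdeal.retractClosure_extensionProduct (hK : IsStronglyClosed K)
    {P Q : ObjectProperty K} (hP : IsThickIdeal P) (hQ : IsThickIdeal Q) :
    IsThickIdeal (P.extensionProduct Q).retractClosure where
  isTriangulated := by
    have := hP.isTriangulated
    have := hP.isClosedUnderIsomorphisms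
    have := hQ.isTriangulated
    have := hQ.isClosedUnderIsomorphisms
    have := hK.isVerdierLeftLocalizing hP hQ
    have := extensionProduct_isTriangulated (A := P) (B := Q)
    exact retractClosure_isTriangulated _
  isStableUnderRetracts := inferInstance
  tensor_mem := by
    rintro a b ⟨c, ⟨p, q, f, g, h, hT, hp, hq⟩, ⟨r⟩⟩
    let _ := TensorTriangulated.commShift (K := K)
    have := TensorTriangulated.exact_right b
    exact ⟨c ⊗ b, ⟨_, _, _, _, _, ((curriedTensor K).flip.obj b).map_distinguished _ hT,
      hP.tensor_mem p b hp, hQ.tensor_mem q b hq⟩, ⟨r.map (tensorRight b)⟩⟩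

/-- Objects supported on a union are generated by objects supported on each part. -/
lemma supportedOn_union (hK : IsStronglyClosed K) (a b : K) :
    supportedOn (supp a ∪ supp b) =
      ((supportedOn (supp a)).extensionProduct (supportedOn (supp b))).retractClosure := by
  have hI := (isThickIdeal_supportedOn (supp a)).retractClosure_extensionProduct hK
    (isThickIdeal_supportedOn (supp b))
  apply le_antisymm
  · intro x hx
    -- Otherwise a prime avoiding x contains the right-hand side, in particular a and b; it then
    -- lies in supp x but in neither supp a nor supp b.
    by_contra h
    obtain ⟨P, hP, hPx⟩ := hI.exists_prime hK h
    rcases hx hPx with h | h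
    · exact h (hP _ (ObjectProperty.le_retractClosure _ _
        (ObjectProperty.le_extensionProduct_left _ _ (subset_refl (supp a)))))
    · exact h (hP _ (ObjectProperty.le_retractClosure _ _
        (ObjectProperty.le_extensionProduct_right _ _ (subset_refl (supp b)))))
  · rw [ObjectProperty.retractClosure_le_iff]
    exact ObjectProperty.extensionProduct_le_of_isTriangulatedClosed₂
      (supportedOn_mono Set.subset_union_left) (supportedOn_mono Set.subset_union_right)

end Decomposition

/-! ### Morphisms over an open subset -/

section HomOver

variable {K : Type u} [Category.{v} K] [Preadditive K] [HasZeroObject K]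
  [HasShift K ℤ] [∀ n : ℤ, (shiftFunctor K n).Additive] [Pretriangulated K]
  [MonoidalCategory K]

/-- The morphisms over `U` between two objects of `K`. -/
abbrev HomOver (U : Opens (Spc K)) (a b : K) := (isoOver U).Q.obj a ⟶ (isoOver U).Q.obj b

/-- Restriction of morphisms. -/
noncomputable def rs {U V : Opens (Spc K)} (h : V ≤ U) {a b : K} (f : HomOver U a b) :
    HomOver V a b :=
  (resL h).map f

variable {U V W : Opens (Spc K)} (h : V ≤ U) (h' : W ≤ V) {a b c : K}

@[simp]
lemma rs_comp (f : HomOver U a b) (g : HomOver U b c) : rs h (f ≫ g) = rs h f ≫ rs h g :=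
  (resL h).map_comp f g

@[simp]
lemma rs_id : rs h (𝟙 ((isoOver U).Q.obj a)) = 𝟙 ((isoOver V).Q.obj a) :=
  (resL h).map_id _

@[simp]
lemma rs_Q (f : a ⟶ b) : rs h ((isoOver U).Q.map f) = (isoOver V).Q.map f :=
  (Functor.congr_hom (Q_comp_resL h) f).trans
    ((Category.id_comp _).trans (Category.comp_id _))

@[simp]
lemma rs_rs (f : HomOver U a b) : rs h' (rs h f) = rs (h'.trans h) f :=
  (Functor.congr_hom (resL_comp h h') f).trans
    ((Category.id_comp _).trans (Category.comp_id _))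

lemma isIso_Q_map {f : a ⟶ b} (hf : isoOver U f) : IsIso ((isoOver U).Q.map f) :=
  Localization.inverts (isoOver U).Q (isoOver U) f hf

/-- The inverse over `U` of a morphism with cone supported on the complement of `U`. -/
noncomputable def Qinv {f : a ⟶ b} (hf : isoOver U f) : HomOver U b a :=
  have := isIso_Q_map hf
  inv ((isoOver U).Q.map f)

@[simp]
lemma Q_map_Qinv {f : a ⟶ b} (hf : isoOver U f) : (isoOver U).Q.map f ≫ Qinv hf = 𝟙 _ :=
  have := isIso_Q_map hf
  IsIso.hom_inv_id _

@[simp]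
lemma Qinv_Q_map {f : a ⟶ b} (hf : isoOver U f) : Qinv hf ≫ (isoOver U).Q.map f = 𝟙 _ :=
  have := isIso_Q_map hf
  IsIso.inv_hom_id _

@[simp]
lemma Q_map_Qinv_assoc {f : a ⟶ b} (hf : isoOver U f) (g : HomOver U a c) :
    (isoOver U).Q.map f ≫ Qinv hf ≫ g = g := by
  rw [← Category.assoc, Q_map_Qinv, Category.id_comp]

@[simp]
lemma Qinv_Q_map_assoc {f : a ⟶ b} (hf : isoOver U f) (g : HomOver U b c) :
    Qinv hf ≫ (isoOver U).Q.map f ≫ g = g := by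
  rw [← Category.assoc, Qinv_Q_map, Category.id_comp]

@[simp]
lemma rs_Qinv {f : a ⟶ b} (hf : isoOver U f) :
    rs h (Qinv hf) = Qinv (isoOver_mono h _ hf) := by
  have := isIso_Q_map (isoOver_mono h _ hf)
  rw [← cancel_epi ((isoOver V).Q.map f), Q_map_Qinv, ← rs_Q h, ← rs_comp, Q_map_Qinv, rs_id]

variable [IsTriangulated K]

instance : (resL h).Additive := by
  rw [Localization.functor_additive_iff (isoOver U).Q (isoOver U), Q_comp_resL]
  infer_instance

@[simp]
lemma rs_add (f g : HomOver U a b) : rs h (f + g) = rs h f + rs h g :=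
  (resL h).map_add

@[simp]
lemma rs_sub (f g : HomOver U a b) : rs h (f - g) = rs h f - rs h g :=
  (resL h).map_sub

/-- Morphisms which become invertible over `U` have a cone supported on the complement of
`U`. -/
lemma isoOver_of_isIso_Q_map {f : a ⟶ b} [IsIso ((isoOver U).Q.map f)] : isoOver U f := by
  obtain ⟨d, g, w, hT⟩ := Pretriangulated.distinguished_cocone_triangle f
  refine ⟨d, g, w, hT, ?_⟩
  have hd : IsZero ((isoOver U).Q.obj d) :=
    Pretriangulated.Triangle.isZero₃_of_isIso₁ _ ((isoOver U).Q.map_distinguished _ hT)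
      (inferInstanceAs (IsIso ((isoOver U).Q.map f)))
  have h₀ : (isoOver U).Q.map (𝟙 d) = (isoOver U).Q.map 0 := hd.eq_of_src _ _
  rw [MorphismProperty.map_eq_iff_precomp _ (isoOver U)] at h₀
  -- A denominator kills the identity of d, so d is a retract of the cone k of that denominator.
  obtain ⟨e, s, ⟨k, t, t', hT', hk⟩, hs⟩ := h₀
  obtain ⟨r, hr⟩ : ∃ r : k ⟶ d, 𝟙 d = t ≫ r :=
    Pretriangulated.Triangle.yoneda_exact₂ _ hT' (𝟙 d) (hs.trans comp_zero)
  exact ObjectProperty.prop_of_retract _ ⟨t, r, hr.symm⟩ hk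

lemma exists_denominator (f : HomOver U a b) :
    ∃ (d : K) (s : d ⟶ a) (g : d ⟶ b), isoOver U s ∧
      (isoOver U).Q.map s ≫ f = (isoOver U).Q.map g := by
  obtain ⟨φ, rfl⟩ := Localization.exists_rightFraction (isoOver U).Q (isoOver U) f
  exact ⟨_, φ.s, φ.f, φ.hs, φ.map_s_comp_map _ _⟩

lemma exists_common_denominator {d d' : K} {f : HomOver U a b} {s : d ⟶ a} {g : d ⟶ b}
    {s' : d' ⟶ a} {g' : d' ⟶ b} (hs : isoOver U s) (hs' : isoOver U s')
    (hf : (isoOver U).Q.map s ≫ f = (isoOver U).Q.map g)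
    (hf' : (isoOver U).Q.map s' ≫ f = (isoOver U).Q.map g') :
    ∃ (e : K) (t : e ⟶ d) (t' : e ⟶ d'), t ≫ s = t' ≫ s' ∧ t ≫ g = t' ≫ g' ∧
      isoOver U (t ≫ s) := by
  have := isIso_Q_map hs
  have := isIso_Q_map hs'
  let φ : (isoOver U).RightFraction a b := ⟨s, hs, g⟩
  let φ' : (isoOver U).RightFraction a b := ⟨s', hs', g'⟩
  have h₁ : φ.map (isoOver U).Q (Localization.inverts _ _) = f := by
    rw [← cancel_epi ((isoOver U).Q.map s), hf]
    exact φ.map_s_comp_map _ _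
  have h₂ : φ'.map (isoOver U).Q (Localization.inverts _ _) = f := by
    rw [← cancel_epi ((isoOver U).Q.map s'), hf']
    exact φ'.map_s_comp_map _ _
  obtain ⟨e, t, t', h₃, h₄, h₅⟩ := (MorphismProperty.RightFraction.map_eq_iff _ _ φ φ').1 (h₁.trans h₂.symm)
  exact ⟨e, t, t', h₃, h₄, h₅⟩

/-- An object supported on the complement of `U` vanishes over `U`. -/
lemma Q_map_comp_eq_zero {d : K} (hd : supportedOn ((U : Set (Spc K))ᶜ) d) (f : a ⟶ d)
    (g : d ⟶ b) : (isoOver U).Q.map (f ≫ g) = 0 := by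
  obtain ⟨e, s, w, hT⟩ := Pretriangulated.distinguished_cocone_triangle₁ f
  have hs : s ≫ f = 0 := Pretriangulated.comp_distTriang_mor_zero₁₂ _ hT
  rw [← (isoOver U).Q.map_zero, MorphismProperty.map_eq_iff_precomp _ (isoOver U)]
  exact ⟨e, s, ⟨_, _, _, hT, hd⟩, by rw [reassoc_of% hs, zero_comp, comp_zero]⟩

/-- The product of two morphisms over `W` vanishing over `U` and `V` respectively is zero when
`W` is the union of `U` and `V`. -/
lemma comp_eq_zero_of_rs_eq_zero [BraidedCategory K] (hK : IsStronglyClosed K)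
    {U V W : Opens (Spc K)} (hW : W = U ⊔ V) (hU : U ≤ W) (hV : V ≤ W) {f : HomOver W a b}
    {g : HomOver W b c} (hf : rs hU f = 0) (hg : rs hV g = 0) : f ≫ g = 0 := by
  obtain ⟨d, s, f₀, hs, hf₀⟩ := exists_denominator f
  have := isIso_Q_map hs
  obtain ⟨φ, rfl⟩ := Localization.exists_leftFraction (isoOver W).Q (isoOver W) g
  have hφ := φ.map_comp_map_s (isoOver W).Q (Localization.inverts _ _)
  have := isIso_Q_map φ.hs
  rw [← cancel_epi ((isoOver W).Q.map s), ← cancel_mono ((isoOver W).Q.map φ.s), Category.assoc,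
    Category.assoc, hφ, reassoc_of% hf₀, comp_zero, zero_comp, ← Functor.map_comp]
  replace hf₀ := congr_arg (rs hU) hf₀
  rw [rs_comp, hf, comp_zero, rs_Q, ← (isoOver U).Q.map_zero, eq_comm,
    MorphismProperty.map_eq_iff_precomp _ (isoOver U)] at hf₀
  obtain ⟨e, t, ⟨k, t', t'', hT, hk⟩, ht⟩ := hf₀
  obtain ⟨k₁, hk₁⟩ : ∃ k₁ : k ⟶ b, f₀ = t' ≫ k₁ :=
    Pretriangulated.Triangle.yoneda_exact₂ _ hT f₀ (ht.trans comp_zero)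
  replace hφ := congr_arg (rs hV) hφ
  rw [rs_comp, hg, zero_comp, rs_Q, ← (isoOver V).Q.map_zero, eq_comm,
    MorphismProperty.map_eq_iff_postcomp _ (isoOver V)] at hφ
  obtain ⟨e', r, hr, hr'⟩ := hφ
  obtain ⟨l, r', r'', hT', hl⟩ := (ObjectProperty.trW_iff' _ _).1 hr
  obtain ⟨l₁, hl₁⟩ : ∃ l₁ : b ⟶ l, φ.f = l₁ ≫ r' :=
    Pretriangulated.Triangle.coyoneda_exact₂ _ hT' φ.f (hr'.trans zero_comp)
  -- Vanishing of f over U puts k, supported off U, in the middle; vanishing of g over V puts l,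
  -- supported off V. The map k ⟶ l then passes through an object supported off U ∪ V, which dies
  -- over W.
  obtain ⟨m, x, y, hm, hm', hxy⟩ := hK.exists_factorization_thickIdeal
    (isThickIdeal_supportedOn _) (isThickIdeal_supportedOn _) (k₁ ≫ l₁) hk hl
  have hmW : supportedOn ((W : Set (Spc K))ᶜ) m := by
    intro P hP
    rw [hW, Opens.coe_sup, Set.compl_union]
    exact ⟨hm hP, hm' hP⟩
  have : f₀ ≫ φ.f = (t' ≫ x) ≫ (y ≫ r') := by
    rw [hk₁, hl₁, Category.assoc, Category.assoc, reassoc_of% hxy]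
  rw [this, Q_map_comp_eq_zero hmW]

end HomOver

/-! ### Gluing in the Verdier quotients over two open subsets -/

section MayerVietoris

variable {K : Type u} [Category.{v} K] [Preadditive K] [HasZeroObject K]
  [HasShift K ℤ] [∀ n : ℤ, (shiftFunctor K n).Additive] [Pretriangulated K]
  [MonoidalCategory K]

/-- `W` and `N` are the union and the intersection of `U` and `V`, whose complements are
supports of objects. -/
structure IsMayerVietoris (U V W N : Opens (Spc K)) : Prop where
  sup_eq : W = U ⊔ V
  inf_eq : N = U ⊓ V
  exists_left : ∃ a : K, (U : Set (Spc K))ᶜ = supp a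
  exists_right : ∃ a : K, (V : Set (Spc K))ᶜ = supp a

namespace IsMayerVietoris

variable {U V W N : Opens (Spc K)} (h : IsMayerVietoris U V W N)

lemma left_le (h : IsMayerVietoris U V W N) : U ≤ W := h.sup_eq ▸ le_sup_left
lemma right_le (h : IsMayerVietoris U V W N) : V ≤ W := h.sup_eq ▸ le_sup_right
lemma le_left (h : IsMayerVietoris U V W N) : N ≤ U := h.inf_eq ▸ inf_le_left
lemma le_right (h : IsMayerVietoris U V W N) : N ≤ V := h.inf_eq ▸ inf_le_right

lemma isoOver_sup (h : IsMayerVietoris U V W N) : isoOver W =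
    (supportedOn ((U : Set (Spc K))ᶜ) ⊓ supportedOn ((V : Set (Spc K))ᶜ)).trW := by
  have : supportedOn ((W : Set (Spc K))ᶜ) =
      supportedOn ((U : Set (Spc K))ᶜ) ⊓ supportedOn ((V : Set (Spc K))ᶜ) := by
    ext x
    rw [h.sup_eq, Opens.coe_sup, Set.compl_union]
    exact Set.subset_inter_iff
  rw [isoOver, this]

variable [BraidedCategory K] [TensorTriangulated K] [IsTriangulated K]

lemma isoOver_inf (h : IsMayerVietoris U V W N) (hK : IsStronglyClosed K) : isoOver N =
    ((supportedOn ((U : Set (Spc K))ᶜ)).extensionProduct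
      (supportedOn ((V : Set (Spc K))ᶜ))).retractClosure.trW := by
  obtain ⟨a, ha⟩ := h.exists_left
  obtain ⟨b, hb⟩ := h.exists_right
  rw [isoOver, h.inf_eq, Opens.coe_inf, Set.compl_inter, ha, hb, supportedOn_union hK]

/-- Morphisms over `U` and `V` which agree over the intersection glue. -/
theorem exists_hom (h : IsMayerVietoris U V W N) (hK : IsStronglyClosed K) {a b : K}
    (f₁ : HomOver U a b) (f₂ : HomOver V a b) (hf : rs h.le_left f₁ = rs h.le_right f₂) :
    ∃ f : HomOver W a b, rs h.left_le f = f₁ ∧ rs h.right_le f = f₂ := by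
  have := hK.isVerdierLeftLocalizing (isThickIdeal_supportedOn ((U : Set (Spc K))ᶜ))
    (isThickIdeal_supportedOn ((V : Set (Spc K))ᶜ))
  have := hK.isVerdierRightLocalizing (isThickIdeal_supportedOn ((U : Set (Spc K))ᶜ))
    (isThickIdeal_supportedOn ((V : Set (Spc K))ᶜ))
  obtain ⟨d₁, s₁, g₁, hs₁, hf₁⟩ := exists_denominator f₁
  obtain ⟨d₂, s₂, g₂, hs₂, hf₂⟩ := exists_denominator f₂
  obtain ⟨e, t₁, t₂, hts, htg, ht⟩ := exists_common_denominator
    (isoOver_mono h.le_left _ hs₁) (isoOver_mono h.le_right _ hs₂)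
    (f := rs h.le_left f₁) (by simpa using congr_arg (rs h.le_left) hf₁)
    (by simpa [hf] using congr_arg (rs h.le_right) hf₂)
  rw [h.isoOver_inf hK] at ht
  obtain ⟨F, s, g, hs, ⟨D, q, v, hq, hqs, hqg⟩, ⟨D', q', v', hq', hqs', hqg'⟩⟩ :=
    exists_common_fraction hs₁ hs₂ hts htg ht
  rw [← h.isoOver_sup] at hs
  have := isIso_Q_map hs
  -- The restrictions are compared after precomposing with q ≫ s₁ = v ≫ s, invertible over the
  -- smaller open subset.
  have aux {V : Opens (Spc K)} (hV : V ≤ W) {d e : K} {q : e ⟶ d} {s₁ : d ⟶ a} {g₁ : d ⟶ b}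
      {v : e ⟶ F} (hq : isoOver V q) (hs₁ : isoOver V s₁) (hs : v ≫ s = q ≫ s₁)
      (hg : v ≫ g = q ≫ g₁) {f₁ : HomOver V a b}
      (hf₁ : (isoOver V).Q.map s₁ ≫ f₁ = (isoOver V).Q.map g₁) :
      rs hV (inv ((isoOver W).Q.map s) ≫ (isoOver W).Q.map g) = f₁ := by
    have := isIso_Q_map ((isoOver V).comp_mem _ _ hq hs₁)
    have H := congr_arg (rs hV)
      (IsIso.hom_inv_id_assoc ((isoOver W).Q.map s) ((isoOver W).Q.map g))
    rw [rs_comp, rs_Q, rs_Q] at H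
    rw [← cancel_epi ((isoOver V).Q.map (q ≫ s₁)), ← hs, Functor.map_comp, Category.assoc, H,
      ← Functor.map_comp, ← Functor.map_comp, hs, hg, Functor.map_comp, Functor.map_comp,
      Category.assoc, hf₁]
  exact ⟨_, aux _ hq hs₁ hqs hqg hf₁, aux _ hq' hs₂ hqs' hqg' hf₂⟩

/-- Isomorphic objects over the intersection glue, after enlarging one of them. -/
theorem exists_object (h : IsMayerVietoris U V W N) (hK : IsStronglyClosed K) {a b : K}
    {φ : HomOver N a b} {ψ : HomOver N b a} (hφψ : φ ≫ ψ = 𝟙 _) (hψφ : ψ ≫ φ = 𝟙 _) :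
    ∃ (c : K) (i : HomOver U a c) (p : HomOver U c a) (β : HomOver V b c) (γ : HomOver V c b),
      i ≫ p = 𝟙 _ ∧ β ≫ γ = 𝟙 _ ∧ γ ≫ β = 𝟙 _ ∧
      rs h.le_left i = φ ≫ rs h.le_right β ∧ rs h.le_left p = rs h.le_right γ ≫ ψ := by
  have := hK.isVerdierLeftLocalizing (isThickIdeal_supportedOn ((U : Set (Spc K))ᶜ))
    (isThickIdeal_supportedOn ((V : Set (Spc K))ᶜ))
  have := hK.isVerdierRightLocalizing (isThickIdeal_supportedOn ((U : Set (Spc K))ᶜ))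
    (isThickIdeal_supportedOn ((V : Set (Spc K))ᶜ))
  -- The fraction is enlarged so that the cone of s is a genuine extension, not just a retract of
  -- one.
  obtain ⟨d, s, t, hs, hst⟩ : ∃ (d : K) (s : d ⟶ a) (t : d ⟶ b),
      ((supportedOn ((U : Set (Spc K))ᶜ)).extensionProduct
        (supportedOn ((V : Set (Spc K))ᶜ))).trW s ∧
      (isoOver N).Q.map s ≫ φ = (isoOver N).Q.map t := by
    obtain ⟨d, s, t, hs, hst⟩ := exists_denominator φ
    rw [h.isoOver_inf hK] at hs
    obtain ⟨d', -, r, -, hr⟩ := exists_retraction_trW_comp _ hs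
    exact ⟨d', r ≫ s, r ≫ t, hr, by rw [Functor.map_comp, Category.assoc, hst,
      ← Functor.map_comp]⟩
  have hsN : isoOver N s := by
    rw [h.isoOver_inf hK]
    exact ObjectProperty.trW_monotone (ObjectProperty.le_retractClosure _) _ hs
  have := isIso_Q_map hsN
  have : IsIso φ := ⟨ψ, hφψ, hψφ⟩
  have : IsIso ((isoOver N).Q.map t) := by
    rw [← hst]
    infer_instance
  have ht : isoOver N t := isoOver_of_isIso_Q_map
  rw [h.isoOver_inf hK] at ht
  obtain ⟨x, e, d₁, d₂, c, κ, ρ, j, r, p₁, q₁, p₂, q₂, v₁, v₂, hκρ, hjr, hsκ, hρ, hpq, hv, hq₁, hp₁,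
    hp₂, hq₂, hv₁, hv₂⟩ := exists_common_object hs ht
  change isoOver U q₁ at hq₁
  change isoOver U v₁ at hv₁
  change isoOver V q₂ at hq₂
  change isoOver V v₂ at hv₂
  change isoOver V p₁ at hp₁
  -- Over U: a ⟶ x ⟵ d₁ ⟶ c, where only κ is not invertible but split by ρ. Over V: b ⟵ d₂ ⟶ c, both
  -- legs invertible.
  refine ⟨c, (isoOver U).Q.map κ ≫ Qinv hq₁ ≫ (isoOver U).Q.map v₁,
    Qinv hv₁ ≫ (isoOver U).Q.map q₁ ≫ (isoOver U).Q.map ρ, Qinv hq₂ ≫ (isoOver V).Q.map v₂,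
    Qinv hv₂ ≫ (isoOver V).Q.map q₂, ?_, by simp, by simp, ?_, ?_⟩
  · simp only [Category.assoc, Q_map_Qinv_assoc, Qinv_Q_map_assoc]
    rw [← Functor.map_comp, hκρ, CategoryTheory.Functor.map_id]
  · rw [← cancel_epi ((isoOver N).Q.map s)]
    simp only [rs_comp, rs_Q, rs_Qinv]
    rw [reassoc_of% hst, ← Functor.map_comp_assoc, hsκ]
    have : t = j ≫ p₂ ≫ q₂ := by rw [hpq, reassoc_of% hjr]
    rw [this]
    simp only [Functor.map_comp, Category.assoc, Q_map_Qinv_assoc]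
    simp only [← Functor.map_comp, hv]
  · have := isIso_Q_map ((isoOver N).comp_mem _ _ (isoOver_mono h.le_right _ hp₁)
      (isoOver_mono h.le_left _ hv₁))
    rw [← cancel_epi ((isoOver N).Q.map (p₁ ≫ v₁))]
    simp only [rs_comp, rs_Q, rs_Qinv]
    conv_rhs => rw [hv]
    simp only [Functor.map_comp, Category.assoc, Q_map_Qinv_assoc]
    simp only [← Functor.map_comp, ← Functor.map_comp_assoc, hpq, hρ]
    simp only [Functor.map_comp, Category.assoc, ← hst, hφψ, Category.comp_id]

end IsMayerVietoris

end MayerVietoris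

/-! ### Gluing over two open subsets -/

section Idempotents

variable {C : Type*} [Category* C]

/-- Inverse isomorphisms, in the idempotent completion, between the images of two idempotents. -/
structure IdemIso {X Y : C} (e : X ⟶ X) (e' : Y ⟶ Y) where
  /-- the direct morphism -/
  hom : X ⟶ Y
  /-- the inverse morphism -/
  inv : Y ⟶ X
  hom_inv : hom ≫ inv = e
  inv_hom : inv ≫ hom = e'
  hom_comp : hom ≫ e' = hom
  inv_comp : inv ≫ e = inv

namespace IdemIso

variable {X Y Z : C} {e : X ⟶ X} {e' : Y ⟶ Y} {e'' : Z ⟶ Z}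

attribute [simp] hom_inv inv_hom hom_comp inv_comp

@[simp]
lemma comp_hom (f : IdemIso e e') : e ≫ f.hom = f.hom :=
  calc e ≫ f.hom = f.hom ≫ f.inv ≫ f.hom := by rw [← Category.assoc, f.hom_inv]
    _ = f.hom := by rw [f.inv_hom, f.hom_comp]

@[simp]
lemma comp_inv (f : IdemIso e e') : e' ≫ f.inv = f.inv :=
  calc e' ≫ f.inv = f.inv ≫ f.hom ≫ f.inv := by rw [← Category.assoc, f.inv_hom]
    _ = f.inv := by rw [f.hom_inv, f.inv_comp]

/-- The inverse isomorphism. -/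
def symm (f : IdemIso e e') : IdemIso e' e :=
  ⟨f.inv, f.hom, f.inv_hom, f.hom_inv, f.inv_comp, f.hom_comp⟩

/-- The composition of isomorphisms. -/
def trans (f : IdemIso e e') (g : IdemIso e' e'') : IdemIso e e'' where
  hom := f.hom ≫ g.hom
  inv := g.inv ≫ f.inv
  hom_inv := by rw [Category.assoc, reassoc_of% g.hom_inv, comp_inv, hom_inv]
  inv_hom := by rw [Category.assoc, reassoc_of% f.inv_hom, comp_hom, inv_hom]
  hom_comp := by simp
  inv_comp := by simp

lemma idem_left (f : IdemIso e e') : e ≫ e = e :=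
  calc e ≫ e = f.hom ≫ f.inv ≫ e := by rw [← Category.assoc, f.hom_inv]
    _ = e := by rw [f.inv_comp, f.hom_inv]

/-- Replace the idempotents by equal ones. -/
def copy (f : IdemIso e e') {e₁ : X ⟶ X} {e₁' : Y ⟶ Y} (h : e = e₁) (h' : e' = e₁') :
    IdemIso e₁ e₁' :=
  ⟨f.hom, f.inv, f.hom_inv.trans h, f.inv_hom.trans h', h' ▸ f.hom_comp, h ▸ f.inv_comp⟩

lemma inv_eq_of_hom_eq {f g : IdemIso e e'} (h : f.hom = g.hom) : f.inv = g.inv :=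
  calc f.inv = f.inv ≫ g.hom ≫ g.inv := by rw [g.hom_inv, f.inv_comp]
    _ = g.inv := by rw [← h, ← Category.assoc, f.inv_hom, g.comp_inv]

end IdemIso

end Idempotents

/-! ### Algebra of idempotents and square-zero corrections -/

section Preadditive

variable {C : Type*} [Category* C] [Preadditive C]

/-- Isomorphic images of idempotents need not come from isomorphic ambient objects. In Z = X ⊕ Y,
however, φ exchanges the two images and is the identity on the complements, which provides an
isomorphism to which `exists_object` applies. -/
lemma exists_involution {X Y Z : C} {l : X ⟶ Z} {r : Y ⟶ Z} {f : Z ⟶ X} {g : Z ⟶ Y}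
    (hlf : l ≫ f = 𝟙 X) (hlg : l ≫ g = 0) (hrf : r ≫ f = 0) (hrg : r ≫ g = 𝟙 Y)
    (hZ : f ≫ l + g ≫ r = 𝟙 Z) {e : X ⟶ X} {e' : Y ⟶ Y} {S : Y ⟶ X} {T : X ⟶ Y}
    (hST : S ≫ T = e') (hTS : T ≫ S = e) (hS : S ≫ e = S) (hT : T ≫ e' = T) :
    ∃ φ : Z ⟶ Z, φ ≫ φ = 𝟙 Z ∧ φ ≫ f ≫ e = g ≫ S ∧ e ≫ l ≫ φ = T ≫ r := by
  have heT : e ≫ T = T := by rw [← hTS, Category.assoc, hST, hT]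
  have heS : e' ≫ S = S := by rw [← hST, Category.assoc, hTS, hS]
  have he : e ≫ e = e := by rw [← hTS, Category.assoc, hTS, hS, hTS]
  have hl : l ≫ (f ≫ T ≫ r + f ≫ (𝟙 X - e) ≫ l + g ≫ S ≫ l + g ≫ (𝟙 Y - e') ≫ r) =
      T ≫ r + (𝟙 X - e) ≫ l := by
    simp [reassoc_of% hlf, reassoc_of% hlg]
  have hr : r ≫ (f ≫ T ≫ r + f ≫ (𝟙 X - e) ≫ l + g ≫ S ≫ l + g ≫ (𝟙 Y - e') ≫ r) =
      S ≫ l + (𝟙 Y - e') ≫ r := by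
    simp [reassoc_of% hrf, reassoc_of% hrg]
  refine ⟨f ≫ T ≫ r + f ≫ (𝟙 X - e) ≫ l + g ≫ S ≫ l + g ≫ (𝟙 Y - e') ≫ r, ?_, ?_, ?_⟩
  · have he' : e' ≫ e' = e' := by rw [← hST, Category.assoc, reassoc_of% hTS, heT]
    rw [Preadditive.add_comp, Preadditive.add_comp, Preadditive.add_comp, Category.assoc,
      Category.assoc, Category.assoc, Category.assoc, Category.assoc, Category.assoc,
      Category.assoc, Category.assoc, hl, hr, ← hZ]
    simp [reassoc_of% hTS, reassoc_of% hST, reassoc_of% hT, reassoc_of% heT, reassoc_of% hS,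
      reassoc_of% heS, reassoc_of% he, reassoc_of% he']
  · have hlf' : l ≫ f ≫ e = e := by rw [reassoc_of% hlf]
    have hrf' : r ≫ f ≫ e = 0 := by rw [reassoc_of% hrf, zero_comp]
    simp [hlf', hrf', he, hS]
  · rw [hl]
    simp [reassoc_of% heT, reassoc_of% he]

/-- The classical lifting p = 3x² - 2x³: it fixes idempotents, and p² - p = (x² - x)²(4x² - 4x - 3).
-/
lemma isIdempotentElem_of_mul_self_eq_zero {R : Type*} [Ring R] {x : R}
    (hx : (x * x - x) * (x * x - x) = 0) :
    IsIdempotentElem (x * x + x * x + x * x - x * (x * x) - x * (x * x)) := by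
  have h : (x * x + x * x + x * x - x * (x * x) - x * (x * x)) *
      (x * x + x * x + x * x - x * (x * x) - x * (x * x)) -
      (x * x + x * x + x * x - x * (x * x) - x * (x * x)) =
      (x * x - x) * (x * x - x) * (4 * (x * x) - 4 * x - 3) := by
    noncomm_ring
  rw [hx, zero_mul, sub_eq_zero] at h
  exact h

lemma idem_of_comp_self_eq_zero {X : C} {f : X ⟶ X} (hf : (f ≫ f - f) ≫ (f ≫ f - f) = 0) :
    (f ≫ f + f ≫ f + f ≫ f - f ≫ f ≫ f - f ≫ f ≫ f) ≫
      (f ≫ f + f ≫ f + f ≫ f - f ≫ f ≫ f - f ≫ f ≫ f) =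
      f ≫ f + f ≫ f + f ≫ f - f ≫ f ≫ f - f ≫ f ≫ f := by
  have := isIdempotentElem_of_mul_self_eq_zero (R := End X) (x := f) hf
  simpa only [IsIdempotentElem, End.mul_def, Category.assoc] using this

/-- Morphisms which are inverse to each other up to square zero morphisms are invertible. -/
lemma exists_idemIso_of_nilpotent {X Y : C} {e : X ⟶ X} {e' : Y ⟶ Y} (he : e ≫ e = e)
    (he' : e' ≫ e' = e') {f : X ⟶ Y} {g : Y ⟶ X} (hef : e ≫ f = f) (hfe : f ≫ e' = f)
    (heg : e' ≫ g = g) (hge : g ≫ e = g) (hfg : (f ≫ g - e) ≫ (f ≫ g - e) = 0)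
    (hgf : (g ≫ f - e') ≫ (g ≫ f - e') = 0) : ∃ φ : IdemIso e e', φ.hom = f := by
  have h₁ : f ≫ g ≫ (e - (f ≫ g - e)) = e := by
    have : f ≫ g ≫ (e - (f ≫ g - e)) = e - (f ≫ g - e) ≫ (f ≫ g - e) := by
      simp only [Preadditive.comp_sub, Preadditive.sub_comp, Category.assoc, hge, he,
        reassoc_of% hef]
      abel
    rw [this, hfg, sub_zero]
  have h₂ : ((e' - (g ≫ f - e')) ≫ g) ≫ f = e' := by
    have : ((e' - (g ≫ f - e')) ≫ g) ≫ f = e' - (g ≫ f - e') ≫ (g ≫ f - e') := by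
      simp only [Preadditive.comp_sub, Preadditive.sub_comp, Category.assoc, hfe, he',
        reassoc_of% heg]
      abel
    rw [this, hgf, sub_zero]
  have h₃ : (e' - (g ≫ f - e')) ≫ g = g ≫ (e - (f ≫ g - e)) := by
    simp only [Preadditive.comp_sub, Preadditive.sub_comp, Category.assoc, hge, heg]
  exact ⟨⟨f, g ≫ (e - (f ≫ g - e)), h₁, by rw [← h₃, h₂], hfe, by
    simp only [Preadditive.sub_comp, Category.assoc, he, hge]⟩, rfl⟩

end Preadditive

variable {K : Type u} [Category.{v} K] [Preadditive K] [HasZeroObject K]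
  [HasShift K ℤ] [∀ n : ℤ, (shiftFunctor K n).Additive] [Pretriangulated K]
  [MonoidalCategory K] [BraidedCategory K] [TensorTriangulated K] [IsTriangulated K]

/-- Restriction of isomorphisms between images of idempotents. -/
noncomputable def IdemIso.rs {U V : Opens (Spc K)} (h : V ≤ U) {a b : K} {e : HomOver U a a}
    {e' : HomOver U b b} (f : IdemIso e e') : IdemIso (TTGeometry.rs h e) (TTGeometry.rs h e') where
  hom := TTGeometry.rs h f.hom
  inv := TTGeometry.rs h f.inv
  hom_inv := by rw [← rs_comp, f.hom_inv]
  inv_hom := by rw [← rs_comp, f.inv_hom]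
  hom_comp := by rw [← rs_comp, f.hom_comp]
  inv_comp := by rw [← rs_comp, f.inv_comp]

namespace IsMayerVietoris

variable {U V W N : Opens (Spc K)}

/-- Idempotents over `U` and `V` which agree over the intersection glue. -/
lemma exists_idem (h : IsMayerVietoris U V W N) (hK : IsStronglyClosed K) {a : K}
    {e₁ : HomOver U a a} {e₂ : HomOver V a a} (he₁ : e₁ ≫ e₁ = e₁) (he₂ : e₂ ≫ e₂ = e₂)
    (he : rs h.le_left e₁ = rs h.le_right e₂) :
    ∃ e : HomOver W a a, e ≫ e = e ∧ rs h.left_le e = e₁ ∧ rs h.right_le e = e₂ := by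
  obtain ⟨f, rfl, rfl⟩ := h.exists_hom hK e₁ e₂ he
  refine ⟨f ≫ f + f ≫ f + f ≫ f - f ≫ f ≫ f - f ≫ f ≫ f, idem_of_comp_self_eq_zero ?_, ?_, ?_⟩
  · exact comp_eq_zero_of_rs_eq_zero hK h.sup_eq h.left_le h.right_le
      (by simp [he₁]) (by simp [he₂])
  · simp [he₁]
  · simp [he₂]

/-- Objects of the idempotent completions over `U` and `V` which are isomorphic over the
intersection glue. -/
theorem exists_idem_object (h : IsMayerVietoris U V W N) (hK : IsStronglyClosed K) {a b : K}
    {e : HomOver U a a} {e' : HomOver V b b} (he : e ≫ e = e) (he' : e' ≫ e' = e')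
    (S : IdemIso (rs h.le_right e') (rs h.le_left e)) :
    ∃ (c : K) (ε : HomOver W c c) (f : IdemIso (rs h.left_le ε) e)
      (g : IdemIso (rs h.right_le ε) e'), ε ≫ ε = ε ∧
      rs h.le_right g.hom ≫ S.hom = rs h.le_left f.hom := by
  obtain ⟨φ, hφ, hφe, heφ⟩ := exists_involution (l := (isoOver N).Q.map (biprod.inl : a ⟶ a ⊞ b))
    (r := (isoOver N).Q.map biprod.inr) (f := (isoOver N).Q.map biprod.fst)
    (g := (isoOver N).Q.map biprod.snd) (by simp [← Functor.map_comp])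
    (by simp [← Functor.map_comp]) (by simp [← Functor.map_comp]) (by simp [← Functor.map_comp])
    (by rw [← Functor.map_comp, ← Functor.map_comp, ← Functor.map_add, biprod.total,
      CategoryTheory.Functor.map_id])
    S.hom_inv S.inv_hom S.hom_comp S.inv_comp
  obtain ⟨c, i, p, β, γ, hip, hβγ, hγβ, hi, hp⟩ := h.exists_object hK hφ hφ
  have hU : (isoOver U).Q.map (biprod.inl : a ⟶ a ⊞ b) ≫ (isoOver U).Q.map biprod.fst = 𝟙 _ := by
    rw [← Functor.map_comp, biprod.inl_fst, CategoryTheory.Functor.map_id]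
  have hV : (isoOver V).Q.map (biprod.inr : b ⟶ a ⊞ b) ≫ (isoOver V).Q.map biprod.snd = 𝟙 _ := by
    rw [← Functor.map_comp, biprod.inr_snd, CategoryTheory.Functor.map_id]
  have hp' : rs h.le_left (p ≫ (isoOver U).Q.map biprod.fst ≫ e) =
      rs h.le_right γ ≫ (isoOver N).Q.map biprod.snd ≫ S.hom := by
    rw [rs_comp, rs_comp, rs_Q, hp, Category.assoc, hφe]
  have hi' : rs h.le_left (e ≫ (isoOver U).Q.map biprod.inl ≫ i) =
      S.inv ≫ (isoOver N).Q.map biprod.inr ≫ rs h.le_right β := by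
    rw [rs_comp, rs_comp, rs_Q, hi, reassoc_of% heφ]
  have hN : rs h.le_right e' ≫ rs h.le_right e' = rs h.le_right e' := by
    rw [← rs_comp, he']
  -- Over U the image of e sits in c through the first summand, over V that of e' through the
  -- second. Over N, φ exchanges the summands, so the two idempotents of c agree.
  obtain ⟨ε, hε, hε₁, hε₂⟩ := h.exists_idem hK
    (e₁ := (p ≫ (isoOver U).Q.map biprod.fst ≫ e) ≫ (e ≫ (isoOver U).Q.map biprod.inl ≫ i))
    (e₂ := (γ ≫ (isoOver V).Q.map biprod.snd ≫ e') ≫ (e' ≫ (isoOver V).Q.map biprod.inr ≫ β))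
    (by simp [reassoc_of% hip, reassoc_of% hU, reassoc_of% he])
    (by simp [reassoc_of% hβγ, reassoc_of% hV, reassoc_of% he'])
    (by
      rw [rs_comp, hp', hi']
      simp [reassoc_of% S.hom_inv, reassoc_of% hN])
  refine ⟨c, ε, ⟨_, _, hε₁.symm, ?_, ?_, ?_⟩, ⟨_, _, hε₂.symm, ?_, ?_, ?_⟩, hε, ?_⟩
  · simp [reassoc_of% hip, reassoc_of% hU, he]
  · simp [he]
  · rw [hε₁]
    simp [reassoc_of% hip, reassoc_of% hU, reassoc_of% he]
  · simp [reassoc_of% hβγ, reassoc_of% hV, he']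
  · simp [he']
  · rw [hε₂]
    simp [reassoc_of% hβγ, reassoc_of% hV, reassoc_of% he']
  · rw [hp']
    simp

/-- Isomorphisms over `U` and `V` which agree over the intersection glue. -/
theorem exists_idemIso (h : IsMayerVietoris U V W N) (hK : IsStronglyClosed K) {a b : K}
    {e : HomOver W a a} {e' : HomOver W b b} (he : e ≫ e = e) (he' : e' ≫ e' = e')
    (f : IdemIso (rs h.left_le e) (rs h.left_le e'))
    (g : IdemIso (rs h.right_le e) (rs h.right_le e'))
    (hfg : rs h.le_left f.hom = rs h.le_right g.hom) :
    ∃ φ : IdemIso e e', rs h.left_le φ.hom = f.hom ∧ rs h.right_le φ.hom = g.hom := by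
  have hinv : rs h.le_left f.inv = rs h.le_right g.inv := by
    exact IdemIso.inv_eq_of_hom_eq
      (f := (f.rs h.le_left).copy (rs_rs _ _ _) (rs_rs _ _ _))
      (g := (g.rs h.le_right).copy (rs_rs _ _ _) (rs_rs _ _ _)) hfg
  obtain ⟨S, hS₁, hS₂⟩ := h.exists_hom hK f.hom g.hom hfg
  obtain ⟨T, hT₁, hT₂⟩ := h.exists_hom hK f.inv g.inv hinv
  have h₁ := f.idem_left
  have h₂ := f.symm.idem_left
  have h₃ := g.idem_left
  have h₄ := g.symm.idem_left
  -- S and T are glued separately, so they are inverse only up to errors vanishing over both U and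
  -- V, which therefore square to zero. The correction alters the inverse and keeps the direct map.
  obtain ⟨φ, hφ⟩ := exists_idemIso_of_nilpotent he he' (f := e ≫ S ≫ e') (g := e' ≫ T ≫ e)
    (by simp [reassoc_of% he]) (by simp [he']) (by simp [reassoc_of% he']) (by simp [he])
    (comp_eq_zero_of_rs_eq_zero hK h.sup_eq h.left_le h.right_le
      (by simp [hS₁, hT₁, h₁]) (by simp [hS₂, hT₂, h₃]))
    (comp_eq_zero_of_rs_eq_zero hK h.sup_eq h.left_le h.right_le
      (by simp [hS₁, hT₁, h₂]) (by simp [hS₂, hT₂, h₄]))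
  exact ⟨φ, by simp [hφ, hS₁], by simp [hφ, hS₂]⟩

end IsMayerVietoris

/-! ### Gluing three objects -/

section Gluing

@[simp]
lemma IdemIso.trans_hom {C : Type*} [Category* C] {X Y Z : C} {e : X ⟶ X} {e' : Y ⟶ Y}
    {e'' : Z ⟶ Z} (f : IdemIso e e') (g : IdemIso e' e'') :
    (f.trans g).hom = f.hom ≫ g.hom := rfl

@[simp]
lemma IdemIso.copy_hom {C : Type*} [Category* C] {X Y : C} {e e₁ : X ⟶ X} {e' e₁' : Y ⟶ Y}
    (f : IdemIso e e') (h : e = e₁) (h' : e' = e₁') : (f.copy h h').hom = f.hom := rfl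

@[simp]
lemma IdemIso.symm_hom {C : Type*} [Category* C] {X Y : C} {e : X ⟶ X} {e' : Y ⟶ Y}
    (f : IdemIso e e') : f.symm.hom = f.inv := rfl

variable {K : Type u} [Category.{v} K] [Preadditive K] [HasZeroObject K]
  [HasShift K ℤ] [∀ n : ℤ, (shiftFunctor K n).Additive] [Pretriangulated K]
  [MonoidalCategory K]

@[simp]
lemma IdemIso.rs_hom {U V : Opens (Spc K)} (h : V ≤ U) {a b : K} {e : HomOver U a a}
    {e' : HomOver U b b} (f : IdemIso e e') : (f.rs h).hom = TTGeometry.rs h f.hom := rfl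

variable [TensorTriangulated K]

/-- The cone has empty support, hence is zero. -/
lemma isIso_of_isoOver_top [BraidedCategory K] (hK : IsStronglyClosed K) {a b : K} {f : a ⟶ b}
    (hf : isoOver ⊤ f) : IsIso f := by
  obtain ⟨d, g, w, hT, hd⟩ := hf
  refine (Pretriangulated.Triangle.isZero₃_iff_isIso₁ _ hT).1 (isZero_of_supp_eq_empty hK ?_)
  rw [← Set.subset_empty_iff]
  exact hd.trans (by simp)

variable [IsTriangulated K]

/-- Idempotents over the whole spectrum split. -/
lemma exists_splitting [BraidedCategory K] [IsIdempotentComplete K] (hK : IsStronglyClosed K)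
    {d : K} {δ : HomOver ⊤ d d} (hδ : δ ≫ δ = δ) :
    ∃ a : K, Nonempty (IdemIso (𝟙 ((isoOver ⊤).Q.obj a)) δ) := by
  obtain ⟨t, s, g, hs, hg⟩ := exists_denominator δ
  -- The denominator is invertible in K, so δ comes from an endomorphism of d; the same argument
  -- shows that this endomorphism is idempotent.
  have := isIso_of_isoOver_top hK hs
  obtain rfl : (isoOver ⊤).Q.map (inv s ≫ g) = δ := by
    rw [Functor.map_comp, ← hg, ← Functor.map_comp_assoc, IsIso.inv_hom_id,
      CategoryTheory.Functor.map_id, Category.id_comp]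
  rw [← Functor.map_comp, MorphismProperty.map_eq_iff_precomp _ (isoOver ⊤)] at hδ
  obtain ⟨t', s', hs', h⟩ := hδ
  have := isIso_of_isoOver_top hK hs'
  obtain ⟨a, i, p, hip, hpi⟩ := IsIdempotentComplete.idempotents_split _ _ ((cancel_epi s').1 h)
  exact ⟨a, ⟨⟨(isoOver ⊤).Q.map i, (isoOver ⊤).Q.map p,
    by rw [← Functor.map_comp, hip, CategoryTheory.Functor.map_id],
    by rw [← Functor.map_comp, hpi], by rw [← Functor.map_comp, ← hpi, reassoc_of% hip],
    Category.comp_id _⟩⟩⟩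

/-- Gluing of three objects, in terms of idempotents. -/
theorem exists_gluing [BraidedCategory K] [IsIdempotentComplete K] (hK : IsStronglyClosed K)
    {U₁ U₂ U₃ : Opens (Spc K)} (hU₁ : IsCompact (U₁ : Set (Spc K)))
    (hU₂ : IsCompact (U₂ : Set (Spc K))) (hU₃ : IsCompact (U₃ : Set (Spc K)))
    (hcover : U₁ ⊔ U₂ ⊔ U₃ = ⊤) {a₁ a₂ a₃ : K} {e₁ : HomOver U₁ a₁ a₁} {e₂ : HomOver U₂ a₂ a₂}
    {e₃ : HomOver U₃ a₃ a₃} (he₁ : e₁ ≫ e₁ = e₁) (he₂ : e₂ ≫ e₂ = e₂) (he₃ : e₃ ≫ e₃ = e₃)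
    (S₁₂ : IdemIso (rs (inf_le_right : U₁ ⊓ U₂ ≤ U₂) e₂) (rs (inf_le_left : U₁ ⊓ U₂ ≤ U₁) e₁))
    (S₁₃ : IdemIso (rs (inf_le_right : U₁ ⊓ U₃ ≤ U₃) e₃) (rs (inf_le_left : U₁ ⊓ U₃ ≤ U₁) e₁))
    (S₂₃ : IdemIso (rs (inf_le_right : U₂ ⊓ U₃ ≤ U₃) e₃) (rs (inf_le_left : U₂ ⊓ U₃ ≤ U₂) e₂))
    (hS : rs (le_inf (inf_le_left.trans inf_le_right) inf_le_right : U₁ ⊓ U₂ ⊓ U₃ ≤ U₂ ⊓ U₃)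
        S₂₃.hom ≫ rs (inf_le_left : U₁ ⊓ U₂ ⊓ U₃ ≤ U₁ ⊓ U₂) S₁₂.hom =
      rs (le_inf (inf_le_left.trans inf_le_left) inf_le_right : U₁ ⊓ U₂ ⊓ U₃ ≤ U₁ ⊓ U₃)
        S₁₃.hom) :
    ∃ (a : K) (q₁ : IdemIso (𝟙 ((isoOver U₁).Q.obj a)) e₁)
      (q₂ : IdemIso (𝟙 ((isoOver U₂).Q.obj a)) e₂) (q₃ : IdemIso (𝟙 ((isoOver U₃).Q.obj a)) e₃),
      rs inf_le_right q₂.hom ≫ S₁₂.hom = rs inf_le_left q₁.hom ∧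
      rs inf_le_right q₃.hom ≫ S₁₃.hom = rs inf_le_left q₁.hom ∧
      rs inf_le_right q₃.hom ≫ S₂₃.hom = rs inf_le_left q₂.hom := by
  obtain ⟨z₁, hz₁⟩ := exists_compl_eq_supp hU₁ U₁.isOpen
  obtain ⟨z₂, hz₂⟩ := exists_compl_eq_supp hU₂ U₂.isOpen
  obtain ⟨z₃, hz₃⟩ := exists_compl_eq_supp hU₃ U₃.isOpen
  have m₁₂ : IsMayerVietoris U₁ U₂ (U₁ ⊔ U₂) (U₁ ⊓ U₂) := ⟨rfl, rfl, ⟨z₁, hz₁⟩, ⟨z₂, hz₂⟩⟩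
  have m₃ : IsMayerVietoris (U₁ ⊓ U₃) (U₂ ⊓ U₃) ((U₁ ⊔ U₂) ⊓ U₃) (U₁ ⊓ U₂ ⊓ U₃) :=
    ⟨inf_sup_right _ _ _, inf_inf_distrib_right _ _ _,
      ⟨z₁ ⊞ z₃, by rw [supp_biprod, ← hz₁, ← hz₃, Opens.coe_inf, Set.compl_inter]⟩,
      ⟨z₂ ⊞ z₃, by rw [supp_biprod, ← hz₂, ← hz₃, Opens.coe_inf, Set.compl_inter]⟩⟩
  have m : IsMayerVietoris (U₁ ⊔ U₂) U₃ ⊤ ((U₁ ⊔ U₂) ⊓ U₃) :=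
    ⟨hcover.symm, rfl,
      ⟨z₁ ⊗ z₂, by rw [supp_tensor, ← hz₁, ← hz₂, Opens.coe_sup, Set.compl_union]⟩, ⟨z₃, hz₃⟩⟩
  obtain ⟨c, ε, f, g, hε, hfg⟩ := m₁₂.exists_idem_object hK he₁ he₂ S₁₂
  have hgf : S₁₂.hom ≫ rs m₁₂.le_left f.inv = rs m₁₂.le_right g.inv :=
    calc S₁₂.hom ≫ rs m₁₂.le_left f.inv
        = rs m₁₂.le_right (g.inv ≫ g.hom) ≫ S₁₂.hom ≫ rs m₁₂.le_left f.inv := by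
          rw [g.inv_hom, reassoc_of% S₁₂.comp_hom]
      _ = rs m₁₂.le_right g.inv ≫ rs m₁₂.le_left (f.hom ≫ f.inv) := by
          rw [rs_comp, Category.assoc, reassoc_of% hfg, rs_comp]
      _ = rs m₁₂.le_right (g.inv ≫ rs m₁₂.right_le ε) := by
          rw [f.hom_inv, rs_comp, rs_rs, rs_rs]
      _ = _ := by rw [g.inv_comp]
  -- S identifies a₃ with the glued object: σ₁₃ followed by f⁻¹ over U₁ ∩ U₃, and σ₂₃ followed by
  -- g⁻¹ over U₂ ∩ U₃. The cocycle relation `hS` and `hgf` give agreement on the triple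
  -- intersection.
  obtain ⟨S, hS₁, hS₂⟩ := m₃.exists_idemIso hK (e := rs inf_le_right e₃)
    (e' := rs inf_le_left ε) (by rw [← rs_comp, he₃]) (by rw [← rs_comp, hε])
    ((S₁₃.trans (f.symm.rs inf_le_left)).copy (rs_rs _ _ _).symm
      ((rs_rs _ _ _).trans (rs_rs _ _ _).symm))
    ((S₂₃.trans (g.symm.rs inf_le_left)).copy (rs_rs _ _ _).symm
      ((rs_rs _ _ _).trans (rs_rs _ _ _).symm)) (by
    have := congr_arg (rs (inf_le_left : U₁ ⊓ U₂ ⊓ U₃ ≤ U₁ ⊓ U₂)) hgf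
    simp only [rs_comp, rs_rs] at this
    simp [← hS, this])
  simp only [IdemIso.copy_hom, IdemIso.trans_hom, IdemIso.rs_hom, IdemIso.symm_hom] at hS₁ hS₂
  obtain ⟨d, δ, f', g', hδ, hfg'⟩ := m.exists_idem_object hK hε he₃ S
  obtain ⟨a, ⟨y⟩⟩ := exists_splitting hK hδ
  -- Restricting the compatibility with S to the two pieces, where S is known, yields the conditions
  -- for σ₁₃ and σ₂₃.
  have h₁ := congr_arg (rs m₃.left_le) hfg'
  have h₂ := congr_arg (rs m₃.right_le) hfg'
  rw [rs_comp, rs_rs, rs_rs, hS₁] at h₁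
  rw [rs_comp, rs_rs, rs_rs, hS₂] at h₂
  refine ⟨a, (((y.rs le_top).copy (rs_id _) (rs_rs _ _ _).symm).trans (f'.rs m₁₂.left_le)).trans f,
    (((y.rs le_top).copy (rs_id _) (rs_rs _ _ _).symm).trans (f'.rs m₁₂.right_le)).trans g,
    ((y.rs le_top).copy (rs_id _) rfl).trans g', ?_, ?_, ?_⟩
  · simp [hfg]
  · have h₃ : rs (inf_le_left : U₁ ⊓ U₃ ≤ U₁) f.inv ≫ rs inf_le_left f.hom = rs inf_le_left e₁ := by
      rw [← rs_comp, f.inv_hom]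
    simp [reassoc_of% h₁.symm, h₃]
  · have h₃ : rs (inf_le_left : U₂ ⊓ U₃ ≤ U₂) g.inv ≫ rs inf_le_left g.hom = rs inf_le_left e₂ := by
      rw [← rs_comp, g.inv_hom]
    simp [reassoc_of% h₂.symm, h₃]

end Gluing

/-! ### Gluing in the idempotent completions -/

section Karoubi

open Idempotents

variable {K : Type u} [Category.{v} K] [Preadditive K] [HasZeroObject K]
  [HasShift K ℤ] [∀ n : ℤ, (shiftFunctor K n).Additive] [Pretriangulated K]
  [MonoidalCategory K]

/-- The object over `U` given by an idempotent. -/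
abbrev idemObj {U : Opens (Spc K)} {c : K} (e : HomOver U c c) (he : e ≫ e = e) : KOver U :=
  ⟨(isoOver U).Q.obj c, e, he⟩

lemma exists_eq_idemObj {U : Opens (Spc K)} (a : KOver U) :
    ∃ (c : K) (e : HomOver U c c) (he : e ≫ e = e), a = idemObj e he :=
  ⟨a.X.as.obj, a.p, a.idem, rfl⟩

section

variable {U U' V W : Opens (Spc K)} {hU : V ≤ U} {hU' : V ≤ U'} {c c' : K}
  {e : HomOver U c c} {he : e ≫ e = e} {e' : HomOver U' c' c'} {he' : e' ≫ e' = e'}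

/-- The isomorphism between images of idempotents given by an isomorphism of the corresponding
objects of the idempotent completion. -/
noncomputable def IdemIso.ofIso (σ : (res hU).obj (idemObj e he) ≅ (res hU').obj (idemObj e' he')) :
    IdemIso (TTGeometry.rs hU e) (TTGeometry.rs hU' e') where
  hom := σ.hom.f
  inv := σ.inv.f
  hom_inv := congr_arg Karoubi.Hom.f σ.hom_inv_id
  inv_hom := congr_arg Karoubi.Hom.f σ.inv_hom_id
  hom_comp := Karoubi.comp_p σ.hom
  inv_comp := Karoubi.comp_p σ.inv

/-- An isomorphism between an object of `K` and the image of an idempotent gives an isomorphism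
in the idempotent completion. -/
noncomputable def IdemIso.toIso (q : IdemIso (𝟙 ((isoOver U).Q.obj c')) e) :
    (rho U).obj c' ≅ idemObj e he where
  hom := ⟨q.hom, by
    change 𝟙 _ ≫ q.hom ≫ e = q.hom
    simp⟩
  inv := ⟨q.inv, by
    change e ≫ q.inv ≫ 𝟙 _ = q.inv
    simp⟩
  hom_inv_id := Karoubi.hom_ext _ _ q.hom_inv
  inv_hom_id := Karoubi.hom_ext _ _ q.inv_hom

/-- The comparison isomorphisms come from equalities of functors, so their underlying maps are the
idempotents themselves, which are absorbed by σ. -/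
lemma restrictIso_hom_f (σ : (res hU).obj (idemObj e he) ≅ (res hU').obj (idemObj e' he'))
    (hW : W ≤ V) : (restrictIso σ hW).hom.f = rs hW (IdemIso.ofIso σ).hom := by
  have h₁ : (((resCompIso hU hW).app (idemObj e he)).inv).f = rs (hW.trans hU) e := by
    simp only [resCompIso, Iso.app_inv, eqToIso.inv, eqToHom_app, Karoubi.eqToHom_f]
    exact Category.comp_id _
  have h₂ : (((resCompIso hU' hW).app (idemObj e' he')).hom).f = rs hW (rs hU' e') := by
    simp only [resCompIso, Iso.app_hom, eqToIso.hom, eqToHom_app, Karoubi.eqToHom_f]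
    exact Category.comp_id _
  have h₃ : rs (hW.trans hU) e ≫ rs hW (IdemIso.ofIso σ).hom ≫ rs hW (rs hU' e') =
      rs hW (IdemIso.ofIso σ).hom := by
    rw [← rs_comp, IdemIso.hom_comp, ← rs_rs hU hW, ← rs_comp, IdemIso.comp_hom]
  exact (congr_arg₂ (fun (x : HomOver W c c) (y : HomOver W c' c') =>
    x ≫ rs hW (IdemIso.ofIso σ).hom ≫ y) h₁ h₂).trans h₃

lemma restrictGlobalIso_hom_f (q : IdemIso (𝟙 ((isoOver U).Q.obj c')) e) (h : V ≤ U) :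
    (restrictGlobalIso (IdemIso.toIso (he := he) q) h).hom.f = rs h q.hom := by
  have h₁ : (((rhoCompIso h).app c').inv).f = 𝟙 ((isoOver V).Q.obj c') := by
    simp only [rhoCompIso, Iso.app_inv, eqToIso.inv, eqToHom_app, Karoubi.eqToHom_f]
    exact Category.comp_id _
  exact (congr_arg (fun (x : HomOver V c' c') => x ≫ rs h q.hom) h₁).trans (Category.id_comp _)

end

end Karoubi

end TTGeometry

/-- Gluing of three objects. Here `σᵢⱼ : aⱼ ≅ aᵢ` over `Uᵢ ∩ Uⱼ`, and `e ≪≫ e'` is the composite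
`e' ∘ e`. -/
theorem mainTheorem4 {K : Type u} [Category.{v} K] [Preadditive K] [HasZeroObject K]
    [HasShift K ℤ] [∀ n : ℤ, (shiftFunctor K n).Additive] [Pretriangulated K]
    [IsTriangulated K] [MonoidalCategory K] [SymmetricCategory K]
    [TTGeometry.TensorTriangulated K] [IsIdempotentComplete K]
    (hK : TTGeometry.IsStronglyClosed K)
    (U₁ U₂ U₃ : Opens (TTGeometry.Spc K))
    (hU₁ : IsCompact (U₁ : Set (TTGeometry.Spc K)))
    (hU₂ : IsCompact (U₂ : Set (TTGeometry.Spc K)))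
    (hU₃ : IsCompact (U₃ : Set (TTGeometry.Spc K)))
    (hcover : U₁ ⊔ U₂ ⊔ U₃ = ⊤)
    (a₁ : TTGeometry.KOver U₁) (a₂ : TTGeometry.KOver U₂) (a₃ : TTGeometry.KOver U₃)
    (σ₁₂ : (TTGeometry.res (inf_le_right : U₁ ⊓ U₂ ≤ U₂)).obj a₂ ≅
      (TTGeometry.res (inf_le_left : U₁ ⊓ U₂ ≤ U₁)).obj a₁)
    (σ₁₃ : (TTGeometry.res (inf_le_right : U₁ ⊓ U₃ ≤ U₃)).obj a₃ ≅
      (TTGeometry.res (inf_le_left : U₁ ⊓ U₃ ≤ U₁)).obj a₁)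
    (σ₂₃ : (TTGeometry.res (inf_le_right : U₂ ⊓ U₃ ≤ U₃)).obj a₃ ≅
      (TTGeometry.res (inf_le_left : U₂ ⊓ U₃ ≤ U₂)).obj a₂)
    (hcocycle :
      TTGeometry.restrictIso σ₂₃ (le_inf (inf_le_left.trans inf_le_right) inf_le_right :
          U₁ ⊓ U₂ ⊓ U₃ ≤ U₂ ⊓ U₃) ≪≫
        TTGeometry.restrictIso σ₁₂ (inf_le_left : U₁ ⊓ U₂ ⊓ U₃ ≤ U₁ ⊓ U₂) =
      TTGeometry.restrictIso σ₁₃ (le_inf (inf_le_left.trans inf_le_left) inf_le_right :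
          U₁ ⊓ U₂ ⊓ U₃ ≤ U₁ ⊓ U₃)) :
    ∃ (a : K) (f₁ : (TTGeometry.rho U₁).obj a ≅ a₁) (f₂ : (TTGeometry.rho U₂).obj a ≅ a₂)
      (f₃ : (TTGeometry.rho U₃).obj a ≅ a₃),
      TTGeometry.restrictGlobalIso f₂ (inf_le_right : U₁ ⊓ U₂ ≤ U₂) ≪≫ σ₁₂ =
          TTGeometry.restrictGlobalIso f₁ (inf_le_left : U₁ ⊓ U₂ ≤ U₁) ∧
        TTGeometry.restrictGlobalIso f₃ (inf_le_right : U₁ ⊓ U₃ ≤ U₃) ≪≫ σ₁₃ =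
          TTGeometry.restrictGlobalIso f₁ (inf_le_left : U₁ ⊓ U₃ ≤ U₁) ∧
        TTGeometry.restrictGlobalIso f₃ (inf_le_right : U₂ ⊓ U₃ ≤ U₃) ≪≫ σ₂₃ =
          TTGeometry.restrictGlobalIso f₂ (inf_le_left : U₂ ⊓ U₃ ≤ U₂) := by
  obtain ⟨c₁, e₁, he₁, rfl⟩ := TTGeometry.exists_eq_idemObj a₁
  obtain ⟨c₂, e₂, he₂, rfl⟩ := TTGeometry.exists_eq_idemObj a₂
  obtain ⟨c₃, e₃, he₃, rfl⟩ := TTGeometry.exists_eq_idemObj a₃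
  have hS := congr_arg (fun f => f.hom.f) hcocycle
  change (TTGeometry.restrictIso _ _).hom.f ≫ (TTGeometry.restrictIso _ _).hom.f =
    (TTGeometry.restrictIso _ _).hom.f at hS
  rw [TTGeometry.restrictIso_hom_f, TTGeometry.restrictIso_hom_f,
    TTGeometry.restrictIso_hom_f] at hS
  obtain ⟨a, q₁, q₂, q₃, h₁₂, h₁₃, h₂₃⟩ := TTGeometry.exists_gluing hK hU₁ hU₂ hU₃ hcover
    he₁ he₂ he₃ (.ofIso σ₁₂) (.ofIso σ₁₃) (.ofIso σ₂₃) hS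
  refine ⟨a, q₁.toIso, q₂.toIso, q₃.toIso, ?_, ?_, ?_⟩
  all_goals
    apply Iso.ext
    apply Idempotents.Karoubi.hom_ext
    change (TTGeometry.restrictGlobalIso _ _).hom.f ≫ _ = _
    rw [TTGeometry.restrictGlobalIso_hom_f, TTGeometry.restrictGlobalIso_hom_f]
    assumption
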